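/- Let $3\le l\le r$ be integers. For $\epsilon\in[0,1]$ and $p\in[0,1]$ let $$W_s(p)=W_s(p;\epsilon)=\Big(1-\frac1r\Big)(1-p)^{\frac r{r-1}}-(1-p)+\frac1r-\frac{\epsilon}{l}\,p^{l}$$ be the potential of the uncoupled $(l,r)$-regular ensemble on the binary erasure channel. Let $\epsilon_{\mathrm{MAP}}$ be the MAP threshold, i.e. the supremum of the $\epsilon\in[0,1]$ for which $W_s(p;\epsilon)\ge 0$ for all $p\in[0,1]$, and let $p_{\mathrm{MAP}}\in(0,1]$ be the (largest) positive zero of $W_s(\cdot\,;\epsilon_{\mathrm{MAP}})$. Fix $\epsilon=\epsilon_{\mathrm{MAP}}$ and consider the continuum potential functional of the spatially coupled ensemble, $$\mathcal W[p]=\int_{\mathbb R}\Big\{\Big(1-\frac1r\Big)(1-p(z))^{\frac r{r-1}}-(1-p(z))+\frac1r-\frac{\epsilon}{l}\Big(\int_0^1p(z+u)\,du\Big)^{l}\Big\}\,dz .$$ Let $\mathcal S$ be the set of continuous $p:\mathbb R\to[0,\infty)$ with $\lim_{z\to-\infty}z\,p(z)=0$ and $\lim_{z\to+\infty}z\,(p(z)-p_{\mathrm{MAP}})=0$,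 let $\mathcal S'$ be the set of (weakly) increasing $p\in\mathcal S$, and $\mathcal S''_0$ the set of strictly increasing $p\in\mathcal S$ with $p(0)=p_{\mathrm{MAP}}/2$. For $p_0,p_1\in\mathcal S'$ and $\lambda\in[0,1]$ let $z_i(q)=\inf\{z: p_i(z)>q\}\in[-\infty,\infty]$ be the inverses, $z_\lambda=(1-\lambda)z_0+\lambda z_1$, and $p_\lambda(z)=\inf\{q: z_\lambda(q)>z\}$ the interpolating profile. Then the integral defining $\mathcal W[p]$ converges absolutely for every $p\in\mathcal S'$, and: (i) $\mathcal W$ is displacement convex on $\mathcal S'$: for all $p_0,p_1\in\mathcal S'$ and $\lambda\in[0,1]$, $p_\lambda\in\mathcal S'$ and $\mathcal W[p_\lambda]\le(1-\lambda)\mathcal W[p_0]+\lambda\mathcal W[p_1]$. (ii) $\mathcal W$ is strictly displacement convex on $\mathcal S''_0$: for all $p_0,p_1\in\mathcal S''_0$ and $\lambda\in[0,1]$, $p_\lambda\in\mathcal S''_0$, and if $p_0\ne p_1$ and $0<\lambda<1$, then $\mathcal W[p_\lambda]<(1-\lambda)\mathcal W[p_0]+\lambda\mathcal W[p_1]$.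 -/

import Mathlib

open Set Filter Topology MeasureTheory

noncomputable section

namespace SpatialCoupling

/-- The potential `W_s(p)` of the uncoupled `(l, r)`-regular ensemble on the binary erasure
channel with erasure parameter `ε`, as a function of the check-erasure probability `p`. -/
def singlePotential (l r : ℕ) (ε p : ℝ) : ℝ :=
  (1 - 1 / (r : ℝ)) * (1 - p) ^ ((r : ℝ) / ((r : ℝ) - 1)) - (1 - p) + 1 / (r : ℝ)
    - ε / (l : ℝ) * p ^ l

/-- The MAP threshold: the largest channel parameter for which the potential of the uncoupled
ensemble is nonnegative, that is, for which `p = 0` is still a global minimizer. -/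
def epsMAP (l r : ℕ) : ℝ :=
  sSup {ε : ℝ | ε ∈ Icc (0 : ℝ) 1 ∧ ∀ p ∈ Icc (0 : ℝ) 1, 0 ≤ singlePotential l r ε p}

/-- The second minimizer (besides `0`) of the potential at the MAP threshold: the largest
`p ∈ [0, 1]` at which the potential vanishes. -/
def pMAP (l r : ℕ) : ℝ :=
  sSup {p : ℝ | p ∈ Icc (0 : ℝ) 1 ∧ singlePotential l r (epsMAP l r) p = 0}

/-- The integrand of the continuum potential functional at the position `z`. -/
def potentialDensity (l r : ℕ) (ε : ℝ) (p : ℝ → ℝ) (z : ℝ) : ℝ :=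
  (1 - 1 / (r : ℝ)) * (1 - p z) ^ ((r : ℝ) / ((r : ℝ) - 1)) - (1 - p z) + 1 / (r : ℝ)
    - ε / (l : ℝ) * (∫ u in (0 : ℝ)..1, p (z + u)) ^ l

/-- The continuum potential functional `W[p]` of the spatially coupled ensemble. -/
def potential (l r : ℕ) (ε : ℝ) (p : ℝ → ℝ) : ℝ :=
  ∫ z, potentialDensity l r ε p z

/-- The space `S` of continuous nonnegative profiles which run from `0` to `m`, with
`z p(z) → 0` at `-∞` and `z (p(z) - m) → 0` at `+∞`. -/
def profiles (m : ℝ) : Set (ℝ → ℝ) :=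
  {p | Continuous p ∧ (∀ z, 0 ≤ p z) ∧ Tendsto (fun z => z * p z) atBot (𝓝 0) ∧
    Tendsto (fun z => z * (p z - m)) atTop (𝓝 0)}

/-- The space `S'` of increasing profiles (flat parts are allowed). -/
def increasingProfiles (m : ℝ) : Set (ℝ → ℝ) :=
  {p | p ∈ profiles m ∧ Monotone p}

/-- The space `S''` of strictly increasing profiles. -/
def strictProfiles (m : ℝ) : Set (ℝ → ℝ) :=
  {p | p ∈ profiles m ∧ StrictMono p}

/-- The space `S''₀` of strictly increasing profiles pinned at the origin. -/
def pinnedProfiles (m : ℝ) : Set (ℝ → ℝ) :=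
  {p | p ∈ strictProfiles m ∧ p 0 = m / 2}

/-- The inverse `z(q) = inf {z : p(z) > q}` of an increasing profile, in `[-∞, +∞]`. -/
def inverseProfile (p : ℝ → ℝ) (q : ℝ) : EReal :=
  sInf ((fun z : ℝ => (z : EReal)) '' {z : ℝ | q < p z})

/-- The linear interpolation `z_t = (1 - t) z₀ + t z₁` of the inverses of two profiles. For
profiles running from `0` to `m` both inverses are `-∞` below `0`, both are `+∞` from `m` on, and
neither is `+∞` in between, so that `∞ - ∞` does not occur when `0 ≤ t ≤ 1`. -/
def interpolatedInverse (p₀ p₁ : ℝ → ℝ) (t q : ℝ) : EReal :=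
  ((1 - t : ℝ) : EReal) * inverseProfile p₀ q + ((t : ℝ) : EReal) * inverseProfile p₁ q

/-- The interpolating profile `p_t(z) = inf {q : z_t(q) > z}`. -/
def interpolatedProfile (p₀ p₁ : ℝ → ℝ) (t z : ℝ) : ℝ :=
  sInf {q : ℝ | (z : EReal) < interpolatedInverse p₀ p₁ t q}

/-- Displacement convexity of a functional `F` on a space `X` of increasing profiles: `X` is
closed under the interpolation, and `F` is convex along it. -/
def DisplacementConvexOn (X : Set (ℝ → ℝ)) (F : (ℝ → ℝ) → ℝ) : Prop :=
  ∀ p₀ ∈ X, ∀ p₁ ∈ X, ∀ t ∈ Icc (0 : ℝ) 1,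
    interpolatedProfile p₀ p₁ t ∈ X ∧
      F (interpolatedProfile p₀ p₁ t) ≤ (1 - t) * F p₀ + t * F p₁

/-- Strict displacement convexity: the inequality is strict for distinct profiles and
`0 < t < 1`. -/
def StrictDisplacementConvexOn (X : Set (ℝ → ℝ)) (F : (ℝ → ℝ) → ℝ) : Prop :=
  (∀ p₀ ∈ X, ∀ p₁ ∈ X, ∀ t ∈ Icc (0 : ℝ) 1, interpolatedProfile p₀ p₁ t ∈ X) ∧
    ∀ p₀ ∈ X, ∀ p₁ ∈ X, p₀ ≠ p₁ → ∀ t ∈ Ioo (0 : ℝ) 1,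
      F (interpolatedProfile p₀ p₁ t) < (1 - t) * F p₀ + t * F p₁

end SpatialCoupling

end

/-! The functional becomes convex once it is written in terms of the inverse `Z` of the profile,
because displacement interpolation is linear interpolation of inverses. With `m = pMAP l r`, adding
and subtracting `ε/l * p^l` splits the density into `W_s(p(z))` and `-ε/l * (avg^l - p^l)`.

Since `W_s` vanishes at `0` and `m`, the first part integrates to `-∫ W_s'(q) Z(q) dq`, linear in
`Z` (`integral_comp_eq_neg_integral_inverse`). The integral converges because `|Z q| ≤ C₁/q +
C₂/(m-q)` while `W_s'` vanishes at both ends of `(0, m)`.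

For the second part, a profile is the distribution function of its inverse. So `p(z)^l` is the
measure of the `l`-tuples of levels and shifts with `max Z(q_i) ≤ z`, and `avg^l` that of the tuples
with `max (Z(q_i) - u_i) ≤ z`. The excess integrates to the mean of `max Z(q_i) - max (Z(q_i) -
u_i)` (`integral_average_pow_sub_pow`). The first maximum sits at the largest level, hence is linear
in monotone `Z`; the second is convex. The excess is thus concave, and it enters with a minus sign.

Strictness: when `Z₀ - Z₁` is not constant, suitable shifts put two levels in opposite orders for
`Z₀` and `Z₁` (`exists_crossing`). This persists on a set of positive measure, where the second
maximum is strictly convex. Pinning excludes translates, the case of constant difference. -/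

namespace SpatialCoupling

/-! ### The single-system potential at the MAP threshold. -/

/-- The derivative of `singlePotential`. -/
noncomputable def singleDeriv (l r : ℕ) (ε q : ℝ) : ℝ :=
  1 - (1 - q) ^ (1 / ((r : ℝ) - 1)) - ε * q ^ (l - 1)

theorem hasDerivAt_singlePotential {l r : ℕ} (hl : 1 ≤ l) (hr : 2 ≤ r) (ε p : ℝ) :
    HasDerivAt (singlePotential l r ε) (singleDeriv l r ε p) p := by
  have hr' : (2 : ℝ) ≤ r := by exact_mod_cast hr
  have hl' : (1 : ℝ) ≤ l := by exact_mod_cast hl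
  have h1 : (r : ℝ) - 1 ≠ 0 := by linarith
  have hβ : 1 ≤ (r : ℝ) / ((r : ℝ) - 1) := by
    rw [le_div_iff₀ (by linarith)]; linarith
  have hx : HasDerivAt (fun p : ℝ => 1 - p) (-1) p := by
    simpa using (hasDerivAt_id p).const_sub 1
  have h := ((((Real.hasDerivAt_rpow_const (x := 1 - p) (Or.inr hβ)).comp p hx).const_mul
    (1 - 1 / (r : ℝ))).sub hx).add_const (1 / (r : ℝ)) |>.sub
      ((hasDerivAt_pow l p).const_mul (ε / (l : ℝ)))
  refine h.congr_deriv ?_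
  have he : (r : ℝ) / ((r : ℝ) - 1) - 1 = 1 / ((r : ℝ) - 1) := by field_simp; ring
  rw [he, singleDeriv]
  have h2 : (r : ℝ) ≠ 0 := by linarith
  have h3 : (l : ℝ) ≠ 0 := by linarith
  field_simp
  ring

theorem continuous_singleDeriv {l r : ℕ} (hr : 2 ≤ r) (ε : ℝ) :
    Continuous (singleDeriv l r ε) := by
  have hr' : (2 : ℝ) ≤ r := by exact_mod_cast hr
  have hα : 0 ≤ 1 / ((r : ℝ) - 1) := by apply div_nonneg <;> linarith
  unfold singleDeriv
  exact (continuous_const.sub ((continuous_const.sub continuous_id).rpow_const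
    fun _ => Or.inr hα)).sub (continuous_const.mul (continuous_id.pow _))

theorem continuous_singlePotential {l r : ℕ} (hl : 1 ≤ l) (hr : 2 ≤ r) (ε : ℝ) :
    Continuous (singlePotential l r ε) :=
  continuous_iff_continuousAt.2 fun p => (hasDerivAt_singlePotential hl hr ε p).continuousAt

theorem singlePotential_zero_right {l r : ℕ} (hl : 1 ≤ l) (ε : ℝ) :
    singlePotential l r ε 0 = 0 := by
  have : l ≠ 0 := by omega
  simp [singlePotential, this]

/-- Strict Bernoulli inequality for the exponent `r/(r-1)`; the affine terms cancel. -/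
theorem singlePotential_zero_left_pos {l r : ℕ} (hr : 2 ≤ r) {p : ℝ}
    (hp : 0 < p) (hp1 : p ≤ 1) : 0 < singlePotential l r 0 p := by
  have hr' : (2 : ℝ) ≤ r := by exact_mod_cast hr
  have hβ : 1 < (r : ℝ) / ((r : ℝ) - 1) := by
    rw [lt_div_iff₀ (by linarith)]; linarith
  have h := one_add_mul_self_lt_rpow_one_add (s := -p) (by linarith) (by linarith) hβ
  have hc : 0 < 1 - 1 / (r : ℝ) := by
    rw [sub_pos, div_lt_one (by linarith)]; linarith
  have h2 := mul_lt_mul_of_pos_left h hc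
  have h3 : (1 - 1 / (r : ℝ)) * (1 + (r : ℝ) / ((r : ℝ) - 1) * -p) = 1 - 1 / r - p := by
    have h1 : (r : ℝ) - 1 ≠ 0 := by linarith
    field_simp
    ring
  rw [h3, ← sub_eq_add_neg] at h2
  simp only [singlePotential, zero_div, zero_mul, sub_zero]
  linarith

theorem epsMAP_mem {l r : ℕ} (hl : 1 ≤ l) (hr : 2 ≤ r) :
    epsMAP l r ∈ {ε : ℝ | ε ∈ Icc (0 : ℝ) 1 ∧ ∀ p ∈ Icc (0 : ℝ) 1, 0 ≤ singlePotential l r ε p} := by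
  have hset : {ε : ℝ | ε ∈ Icc (0 : ℝ) 1 ∧ ∀ p ∈ Icc (0 : ℝ) 1, 0 ≤ singlePotential l r ε p} =
      Icc 0 1 ∩ ⋂ p ∈ Icc (0 : ℝ) 1, {ε | 0 ≤ singlePotential l r ε p} := by
    ext; simp
  have hc : IsCompact {ε : ℝ | ε ∈ Icc (0 : ℝ) 1 ∧
      ∀ p ∈ Icc (0 : ℝ) 1, 0 ≤ singlePotential l r ε p} := by
    rw [hset]
    refine isCompact_Icc.inter_right (isClosed_biInter fun p _ => isClosed_le continuous_const ?_)
    unfold singlePotential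
    fun_prop
  refine hc.sSup_mem ⟨0, ⟨le_rfl, zero_le_one⟩, fun p hp => ?_⟩
  rcases hp.1.eq_or_lt with h | h
  · rw [← h, singlePotential_zero_right hl]
  · exact (singlePotential_zero_left_pos hr h hp.2).le

theorem pMAP_mem {l r : ℕ} (hl : 1 ≤ l) (hr : 2 ≤ r) :
    pMAP l r ∈ {p : ℝ | p ∈ Icc (0 : ℝ) 1 ∧ singlePotential l r (epsMAP l r) p = 0} := by
  refine IsCompact.sSup_mem ?_ ⟨0, ⟨le_rfl, zero_le_one⟩, singlePotential_zero_right hl _⟩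
  exact isCompact_Icc.inter_right
    (isClosed_eq (continuous_singlePotential hl hr _) continuous_const)

/-- An interior zero of the nonnegative potential is a minimum. At `pMAP = 1` minimality gives only
a derivative `≤ 0`, but there the derivative is `1 - ε ≥ 0`. -/
theorem singleDeriv_pMAP {l r : ℕ} (hl : 2 ≤ l) (hr : 2 ≤ r) :
    singleDeriv l r (epsMAP l r) (pMAP l r) = 0 := by
  have hr' : (2 : ℝ) ≤ r := by exact_mod_cast hr
  obtain ⟨⟨hε0, hε1⟩, hW⟩ := epsMAP_mem (l := l) (r := r) (by omega) hr
  obtain ⟨⟨hm0, hm1⟩, hm⟩ := pMAP_mem (l := l) (r := r) (by omega) hr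
  set ε := epsMAP l r
  set m := pMAP l r
  have hd := hasDerivAt_singlePotential (l := l) (by omega) hr ε m
  have hα : 1 / ((r : ℝ) - 1) ≠ 0 := by
    apply div_ne_zero <;> linarith
  rcases hm0.eq_or_lt with h0 | h0
  · rw [← h0]
    have : l - 1 ≠ 0 := by omega
    simp [singleDeriv, this]
  rcases hm1.eq_or_lt with h1 | h1
  · have hle : singleDeriv l r ε m ≤ 0 := by
      refine le_of_tendsto ((hasDerivWithinAt_iff_tendsto_slope' self_notMem_Iio).1
        (hd.hasDerivWithinAt (s := Iio m))) ?_
      filter_upwards [Ioo_mem_nhdsLT h0] with q hq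
      rw [slope_def_field, hm]
      exact div_nonpos_of_nonneg_of_nonpos
        (by linarith [hW q ⟨hq.1.le, (hq.2.trans_le hm1).le⟩]) (by linarith [hq.2])
    have heq : singleDeriv l r ε m = 1 - ε := by
      rw [h1, singleDeriv, sub_self, Real.zero_rpow hα]; simp
    linarith
  · refine IsLocalMin.hasDerivAt_eq_zero ?_ hd
    filter_upwards [Ioo_mem_nhds h0 h1] with q hq
    rw [hm]
    exact hW q ⟨hq.1.le, hq.2.le⟩

theorem epsMAP_pos {l r : ℕ} (hl : 1 ≤ l) (hr : 2 ≤ r) (hm : 0 < pMAP l r) : 0 < epsMAP l r := by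
  obtain ⟨⟨hε0, -⟩, -⟩ := epsMAP_mem (l := l) (r := r) hl hr
  obtain ⟨⟨-, hm1⟩, hm'⟩ := pMAP_mem (l := l) (r := r) hl hr
  refine hε0.lt_of_ne fun h => ?_
  rw [← h] at hm'
  exact (singlePotential_zero_left_pos hr hm hm1).ne' hm'

/-- Cancels the `1/q` growth of the inverse at level `0`. -/
theorem abs_singleDeriv_le_self {l r : ℕ} (hl : 2 ≤ l) (hr : 2 ≤ r) {ε q : ℝ}
    (hε : ε ∈ Icc (0 : ℝ) 1) (hq : q ∈ Icc (0 : ℝ) 1) : |singleDeriv l r ε q| ≤ q := by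
  have hr' : (2 : ℝ) ≤ r := by exact_mod_cast hr
  obtain ⟨hq0, hq1⟩ := hq
  have hα : 1 / ((r : ℝ) - 1) ≤ 1 := by rw [div_le_one (by linarith)]; linarith
  have hα0 : 0 ≤ 1 / ((r : ℝ) - 1) := by apply div_nonneg <;> linarith
  have h1 := Real.self_le_rpow_of_le_one (sub_nonneg.2 hq1) (by linarith) hα
  have h2 := Real.rpow_le_one (sub_nonneg.2 hq1) (by linarith) hα0
  have h3 : ε * q ^ (l - 1) ≤ q := by
    calc ε * q ^ (l - 1) ≤ 1 * q ^ (l - 1) := by gcongr; exact hε.2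
      _ ≤ q := by rw [one_mul]; exact pow_le_of_le_one hq0 hq1 (by omega)
  have h4 : 0 ≤ ε * q ^ (l - 1) := mul_nonneg hε.1 (by positivity)
  rw [singleDeriv, abs_le]
  constructor <;> linarith

theorem pow_sub_pow_le_mul_sub {q m : ℝ} (hq : 0 ≤ q) (hqm : q ≤ m) (hm : m ≤ 1) (n : ℕ) :
    m ^ n - q ^ n ≤ n * (m - q) := by
  induction n with
  | zero => simp
  | succ n ih =>
    have h1 : m * (m ^ n - q ^ n) ≤ 1 * (m ^ n - q ^ n) :=
      mul_le_mul_of_nonneg_right hm (sub_nonneg.2 (by gcongr))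
    have h2 : q ^ n * (m - q) ≤ 1 * (m - q) :=
      mul_le_mul_of_nonneg_right (pow_le_one₀ hq (hqm.trans hm)) (by linarith)
    push_cast
    rw [pow_succ, pow_succ]
    linarith

/-- Subadditivity of `x ^ (1/(r-1))` gives a Hölder bound at `m`, also valid for `m = 1`. It weakens
the `1/(m-q)` growth of the inverse to an integrable singularity. -/
theorem abs_singleDeriv_le {l r : ℕ} (hr : 2 ≤ r) {ε q m : ℝ}
    (hε : ε ∈ Icc (0 : ℝ) 1) (hq : 0 ≤ q) (hqm : q ≤ m) (hm : m ≤ 1)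
    (h : singleDeriv l r ε m = 0) :
    |singleDeriv l r ε q| ≤ (m - q) ^ (1 / ((r : ℝ) - 1)) + l * (m - q) := by
  have hr' : (2 : ℝ) ≤ r := by exact_mod_cast hr
  have hα : 1 / ((r : ℝ) - 1) ≤ 1 := by rw [div_le_one (by linarith)]; linarith
  have hα0 : 0 ≤ 1 / ((r : ℝ) - 1) := by apply div_nonneg <;> linarith
  have h1 := Real.rpow_add_le_add_rpow (sub_nonneg.2 hm) (sub_nonneg.2 hqm) hα0 hα
  rw [sub_add_sub_cancel] at h1
  have h2 : (1 - m) ^ (1 / ((r : ℝ) - 1)) ≤ (1 - q) ^ (1 / ((r : ℝ) - 1)) :=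
    Real.rpow_le_rpow (by linarith) (by linarith) hα0
  have h3 : ε * (m ^ (l - 1) - q ^ (l - 1)) ≤ l * (m - q) := by
    have h0 : 0 ≤ m ^ (l - 1) - q ^ (l - 1) := sub_nonneg.2 (by gcongr)
    calc ε * (m ^ (l - 1) - q ^ (l - 1)) ≤ 1 * (m ^ (l - 1) - q ^ (l - 1)) := by
          gcongr; exact hε.2
      _ ≤ ((l - 1 : ℕ) : ℝ) * (m - q) := by
          rw [one_mul]; exact pow_sub_pow_le_mul_sub hq hqm hm _
      _ ≤ l * (m - q) := by
          gcongr
          omega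
  have h4 : 0 ≤ ε * (m ^ (l - 1) - q ^ (l - 1)) :=
    mul_nonneg hε.1 (sub_nonneg.2 (by gcongr))
  have h5 : 0 ≤ (m - q) ^ (1 / ((r : ℝ) - 1)) := Real.rpow_nonneg (by linarith) _
  have h6 : 0 ≤ (l : ℝ) * (m - q) := mul_nonneg (by positivity) (by linarith)
  unfold singleDeriv at h ⊢
  rw [abs_le]
  constructor <;> linarith

/-! ### Limits and decay of profiles. -/

section Profiles

variable {m : ℝ} {p : ℝ → ℝ}

theorem tendsto_atBot_of_mem_profiles (hp : p ∈ profiles m) : Tendsto p atBot (𝓝 0) := by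
  have h := hp.2.2.1.mul (tendsto_inv_atBot_zero (𝕜 := ℝ))
  rw [zero_mul] at h
  refine h.congr' ?_
  filter_upwards [eventually_lt_atBot 0] with z hz
  field_simp [hz.ne]

theorem tendsto_atTop_of_mem_profiles (hp : p ∈ profiles m) : Tendsto p atTop (𝓝 m) := by
  have h := (hp.2.2.2.mul (tendsto_inv_atTop_zero (𝕜 := ℝ))).add_const m
  rw [zero_mul, zero_add] at h
  refine h.congr' ?_
  filter_upwards [eventually_gt_atTop 0] with z hz
  field_simp [hz.ne']
  ring

theorem le_of_mem_increasingProfiles (hp : p ∈ increasingProfiles m) (z : ℝ) : p z ≤ m :=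
  hp.2.ge_of_tendsto (tendsto_atTop_of_mem_profiles hp.1) z

theorem strictProfiles_subset : strictProfiles m ⊆ increasingProfiles m :=
  fun _ hp => ⟨hp.1, hp.2.monotone⟩

/-- A monotone, continuous function with decay at both ends in the sense of `profiles` has
`|z| p(z)` bounded on the left half-line. -/
theorem exists_bound_left (hp : p ∈ increasingProfiles m) :
    ∃ C, 0 ≤ C ∧ ∀ z ≤ 0, -z * p z ≤ C := by
  have hm : 0 ≤ m := (hp.1.2.1 0).trans (le_of_mem_increasingProfiles hp 0)
  obtain ⟨N, hN⟩ := eventually_atBot.1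
    (hp.1.2.2.1.eventually (eventually_gt_nhds (show (-1 : ℝ) < 0 by norm_num)))
  refine ⟨1 + |N| * m, by positivity, fun z hz => ?_⟩
  have h0 : 0 ≤ |N| * m := by positivity
  rcases le_total z N with h | h
  · have := hN z h
    linarith
  · have : -z * p z ≤ |N| * m :=
      mul_le_mul (by linarith [neg_abs_le N]) (le_of_mem_increasingProfiles hp z)
        (hp.1.2.1 z) (abs_nonneg _)
    linarith

theorem exists_bound_right (hp : p ∈ increasingProfiles m) :
    ∃ C, 0 ≤ C ∧ ∀ z, 0 ≤ z → z * (m - p z) ≤ C := by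
  have hm : 0 ≤ m := (hp.1.2.1 0).trans (le_of_mem_increasingProfiles hp 0)
  obtain ⟨N, hN⟩ := eventually_atTop.1
    (hp.1.2.2.2.eventually (eventually_gt_nhds (show (-1 : ℝ) < 0 by norm_num)))
  refine ⟨1 + |N| * m, by positivity, fun z hz => ?_⟩
  have h0 : 0 ≤ |N| * m := by positivity
  rcases le_total N z with h | h
  · have := hN z h
    linarith
  · have : z * (m - p z) ≤ |N| * m :=
      mul_le_mul (by linarith [le_abs_self N]) (by linarith [hp.1.2.1 z])
        (by linarith [le_of_mem_increasingProfiles hp z]) (abs_nonneg _)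
    linarith

end Profiles

/-! ### Generalized inverses: continuity on one side is strictness on the other. -/

/-- `Z` is a generalized inverse on `(0, m)` of the profile `p`. -/
structure IsProfileInverse (m : ℝ) (p Z : ℝ → ℝ) : Prop where
  measurable : Measurable Z
  le_of_lt : ∀ q ∈ Ioo 0 m, ∀ z, q < p z → Z q ≤ z
  lt_of_lt : ∀ q ∈ Ioo 0 m, ∀ z, p z < q → z < Z q

namespace IsProfileInverse

variable {m : ℝ} {p Z : ℝ → ℝ}

theorem le_apply (h : IsProfileInverse m p Z) {q z : ℝ} (hq : q ∈ Ioo 0 m) (hz : Z q ≤ z) :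
    q ≤ p z :=
  not_lt.1 fun h' => (h.lt_of_lt q hq z h').not_ge hz

theorem apply_le (h : IsProfileInverse m p Z) {q z : ℝ} (hq : q ∈ Ioo 0 m) (hz : z < Z q) :
    p z ≤ q :=
  not_lt.1 fun h' => (h.le_of_lt q hq z h').not_gt hz

theorem monotoneOn (h : IsProfileInverse m p Z) : MonotoneOn Z (Ioo 0 m) := by
  intro q hq q' hq' hqq'
  rcases hqq'.eq_or_lt with rfl | hlt
  · exact le_rfl
  · exact h.le_of_lt q hq _ (hlt.trans_le (h.le_apply hq' le_rfl))

theorem apply_inverse (h : IsProfileInverse m p Z) (hc : Continuous p) {q : ℝ}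
    (hq : q ∈ Ioo 0 m) : p (Z q) = q := by
  refine le_antisymm ?_ (h.le_apply hq le_rfl)
  refine le_of_tendsto (hc.continuousAt.mono_left nhdsWithin_le_nhds :
    Tendsto p (𝓝[<] (Z q)) (𝓝 (p (Z q)))) ?_
  filter_upwards [self_mem_nhdsWithin] with z hz using h.apply_le hq hz

theorem strictMonoOn (h : IsProfileInverse m p Z) (hc : Continuous p) :
    StrictMonoOn Z (Ioo 0 m) := by
  intro q hq q' hq' hlt
  exact h.lt_of_lt q' hq' _ (by rwa [h.apply_inverse hc hq])

theorem monotone (h : IsProfileInverse m p Z) (h0 : ∀ z, 0 ≤ p z) (hm : ∀ z, p z ≤ m) :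
    Monotone p := by
  intro z z' hz
  by_contra! hlt
  obtain ⟨q, hq1, hq2⟩ := exists_between hlt
  have hq : q ∈ Ioo 0 m := ⟨(h0 z').trans_lt hq1, hq2.trans_le (hm z)⟩
  have h1 := h.le_of_lt q hq z hq2
  have h2 := h.lt_of_lt q hq z' hq1
  linarith

/-- A jump of `p` would be a flat piece of `Z`. Strict monotonicity of inverses survives convex
combination, so continuity passes to the interpolating profile. -/
theorem continuous (h : IsProfileInverse m p Z) (hs : StrictMonoOn Z (Ioo 0 m))
    (h0 : ∀ z, 0 ≤ p z) (hm : ∀ z, p z ≤ m) : Continuous p := by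
  refine continuous_iff_continuousAt.2 fun z => tendsto_order.2 ⟨fun a ha => ?_, fun a ha => ?_⟩
  · rcases lt_or_ge a 0 with hneg | hnn
    · exact Eventually.of_forall fun z' => hneg.trans_le (h0 z')
    obtain ⟨q₂, h2, h2'⟩ := exists_between ha
    obtain ⟨q₁, h1, h1'⟩ := exists_between h2
    have hq₁ : q₁ ∈ Ioo 0 m := ⟨by linarith, by linarith [hm z]⟩
    have hq₂ : q₂ ∈ Ioo 0 m := ⟨by linarith, by linarith [hm z]⟩
    have hlt := (hs hq₁ hq₂ h1').trans_le (h.le_of_lt q₂ hq₂ z h2')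
    filter_upwards [eventually_gt_nhds hlt] with z' hz'
    exact h1.trans_le (h.le_apply hq₁ hz'.le)
  · rcases lt_or_ge m a with hgt | hle
    · exact Eventually.of_forall fun z' => (hm z').trans_lt hgt
    obtain ⟨q, h1, h1'⟩ := exists_between ha
    have hq : q ∈ Ioo 0 m := ⟨(h0 z).trans_lt h1, by linarith⟩
    filter_upwards [eventually_lt_nhds (h.lt_of_lt q hq z h1)] with z' hz'
    exact (h.apply_le hq hz').trans_lt h1'

theorem continuousOn (h : IsProfileInverse m p Z) (hc : Continuous p) (hs : StrictMono p) :
    ContinuousOn Z (Ioo 0 m) := by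
  intro q hq
  have hpq := h.apply_inverse hc hq
  refine tendsto_order.2 ⟨fun a ha => ?_, fun a ha => ?_⟩
  · have : p a < q := hpq ▸ hs ha
    filter_upwards [self_mem_nhdsWithin, nhdsWithin_le_nhds (eventually_gt_nhds this)]
      with q' hq' hlt using h.lt_of_lt q' hq' a hlt
  · obtain ⟨b, hb, hb'⟩ := exists_between ha
    have : q < p b := hpq ▸ hs hb
    filter_upwards [self_mem_nhdsWithin, nhdsWithin_le_nhds (eventually_lt_nhds this)]
      with q' hq' hlt using (h.le_of_lt q' hq' b hlt).trans_lt hb'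

/-- A flat piece of `p` from `z` to `z'` would make `Z` jump: its left limit at that level is at
most `z`, its right limit at least `z'`. -/
theorem strictMono (h : IsProfileInverse m p Z) (hc : ContinuousOn Z (Ioo 0 m))
    (h0 : ∀ z, 0 < p z) (hm : ∀ z, p z < m) : StrictMono p := by
  have hmono := h.monotone (fun z => (h0 z).le) fun z => (hm z).le
  intro z z' hz
  refine (hmono hz.le).lt_of_ne fun heq => ?_
  have hq : p z ∈ Ioo 0 m := ⟨h0 z, hm z⟩
  have hcq : Tendsto Z (𝓝 (p z)) (𝓝 (Z (p z))) := hc.continuousAt (isOpen_Ioo.mem_nhds hq)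
  have h1 : Z (p z) ≤ z := by
    refine le_of_tendsto (hcq.mono_left (nhdsWithin_le_nhds (s := Iio (p z)))) ?_
    filter_upwards [Ioo_mem_nhdsLT hq.1] with q hq'
    exact h.le_of_lt q ⟨hq'.1, hq'.2.trans hq.2⟩ z hq'.2
  have h2 : z' ≤ Z (p z) := by
    refine ge_of_tendsto (hcq.mono_left (nhdsWithin_le_nhds (s := Ioi (p z)))) ?_
    filter_upwards [Ioo_mem_nhdsGT hq.2] with q hq'
    exact (h.lt_of_lt q ⟨hq.1.trans hq'.1, hq'.2⟩ z' (heq ▸ hq'.1)).le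
  linarith

theorem eq_of_eqOn {p' Z' : ℝ → ℝ} (h : IsProfileInverse m p Z) (h' : IsProfileInverse m p' Z')
    (h0 : ∀ z, 0 ≤ p z) (hm : ∀ z, p z ≤ m) (h0' : ∀ z, 0 ≤ p' z) (hm' : ∀ z, p' z ≤ m)
    (hZ : EqOn Z Z' (Ioo 0 m)) : p = p' := by
  funext z
  by_contra hne
  rcases lt_or_gt_of_ne hne with hlt | hlt
  · obtain ⟨q, hq1, hq2⟩ := exists_between hlt
    have hq : q ∈ Ioo 0 m := ⟨(h0 z).trans_lt hq1, hq2.trans_le (hm' z)⟩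
    have h1 := h.lt_of_lt q hq z hq1
    have h2 := h'.le_of_lt q hq z hq2
    rw [hZ hq] at h1
    linarith
  · obtain ⟨q, hq1, hq2⟩ := exists_between hlt
    have hq : q ∈ Ioo 0 m := ⟨(h0' z).trans_lt hq1, hq2.trans_le (hm z)⟩
    have h1 := h'.lt_of_lt q hq z hq1
    have h2 := h.le_of_lt q hq z hq2
    rw [hZ hq] at h2
    linarith

end IsProfileInverse

/-! ### The extended-real inverse of an increasing profile. -/

section Inverse

variable {m : ℝ} {p : ℝ → ℝ}

theorem monotone_inverseProfile (p : ℝ → ℝ) : Monotone (inverseProfile p) := by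
  intro q q' h
  exact sInf_le_sInf (image_mono fun z (hz : q' < p z) => h.trans_lt hz)

theorem inverseProfile_le {q z : ℝ} (h : q < p z) : inverseProfile p q ≤ z :=
  sInf_le ⟨z, h, rfl⟩

theorem lt_inverseProfile (hc : Continuous p) (hmono : Monotone p) {q z : ℝ} (h : p z < q) :
    (z : EReal) < inverseProfile p q := by
  have hev : ∀ᶠ z' in 𝓝[>] z, p z' < q :=
    nhdsWithin_le_nhds (hc.continuousAt.eventually (eventually_lt_nhds h))
  obtain ⟨z', hz', hlt⟩ := (hev.and self_mem_nhdsWithin).exists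
  refine (EReal.coe_lt_coe_iff.2 (show z < z' from hlt)).trans_le (le_sInf ?_)
  rintro _ ⟨w, hw, rfl⟩
  refine EReal.coe_le_coe_iff.2 (not_lt.1 fun hwz => ?_)
  exact (hz'.trans (show q < p w from hw)).not_ge (hmono hwz.le)

theorem inverseProfile_eq_coe (hp : p ∈ increasingProfiles m) {q : ℝ} (hq : q ∈ Ioo 0 m) :
    inverseProfile p q = ((inverseProfile p q).toReal : EReal) := by
  refine (EReal.coe_toReal ?_ ?_).symm
  · obtain ⟨z, hz⟩ := ((tendsto_atTop_of_mem_profiles hp.1).eventually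
      (eventually_gt_nhds hq.2)).exists
    exact ((inverseProfile_le hz).trans_lt (EReal.coe_lt_top z)).ne
  · obtain ⟨z, hz⟩ := ((tendsto_atBot_of_mem_profiles hp.1).eventually
      (eventually_lt_nhds hq.1)).exists
    exact ((EReal.bot_lt_coe z).trans (lt_inverseProfile hp.1.1 hp.2 hz)).ne'

theorem isProfileInverse_toReal (hp : p ∈ increasingProfiles m) :
    IsProfileInverse m p (fun q => (inverseProfile p q).toReal) where
  measurable := measurable_ereal_toReal.comp (monotone_inverseProfile p).measurable
  le_of_lt q hq z h := by
    have := inverseProfile_le h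
    rw [inverseProfile_eq_coe hp hq] at this
    exact EReal.coe_le_coe_iff.1 this
  lt_of_lt q hq z h := by
    have := lt_inverseProfile hp.1.1 hp.2 h
    rw [inverseProfile_eq_coe hp hq] at this
    exact EReal.coe_lt_coe_iff.1 this

end Inverse

/-! ### Closure of the profile spaces under interpolation. -/

section Interpolation

theorem lt_convexCombo_ereal {t : ℝ} (ht : t ∈ Icc (0 : ℝ) 1) {z : ℝ} {a b : EReal}
    (ha : (z : EReal) < a) (hb : (z : EReal) < b) :
    (z : EReal) < ((1 - t : ℝ) : EReal) * a + ((t : ℝ) : EReal) * b := by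
  rcases ht.1.eq_or_lt with rfl | h0
  · simpa using ha
  rcases ht.2.eq_or_lt with rfl | h1
  · simpa using hb
  have h1' : 0 < 1 - t := sub_pos.2 h1
  induction a with
  | bot => exact absurd ha not_lt_bot
  | top =>
    rw [EReal.coe_mul_top_of_pos h1', EReal.top_add_of_ne_bot]
    · exact EReal.coe_lt_top z
    · induction b with
      | bot => exact absurd hb not_lt_bot
      | top => rw [EReal.coe_mul_top_of_pos h0]; simp
      | coe b => rw [← EReal.coe_mul]; exact EReal.coe_ne_bot _
  | coe a =>
    induction b with
    | bot => exact absurd hb not_lt_bot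
    | top =>
      rw [EReal.coe_mul_top_of_pos h0, ← EReal.coe_mul, EReal.coe_add_top]
      exact EReal.coe_lt_top z
    | coe b =>
      rw [EReal.coe_lt_coe_iff] at ha hb
      rw [← EReal.coe_mul, ← EReal.coe_mul, ← EReal.coe_add, EReal.coe_lt_coe_iff]
      nlinarith

theorem convexCombo_ereal_le {t : ℝ} (ht : t ∈ Icc (0 : ℝ) 1) {z : ℝ} {a b : EReal}
    (ha : a ≤ z) (hb : b ≤ z) :
    ((1 - t : ℝ) : EReal) * a + ((t : ℝ) : EReal) * b ≤ z := by
  have h1 : (0 : EReal) ≤ ((1 - t : ℝ) : EReal) := EReal.coe_nonneg.2 (sub_nonneg.2 ht.2)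
  have h0 : (0 : EReal) ≤ (t : EReal) := EReal.coe_nonneg.2 ht.1
  calc ((1 - t : ℝ) : EReal) * a + ((t : ℝ) : EReal) * b
      ≤ ((1 - t : ℝ) : EReal) * z + ((t : ℝ) : EReal) * z := by gcongr
    _ = z := by
      rw [← EReal.coe_mul, ← EReal.coe_mul, ← EReal.coe_add]
      congr 1; ring

variable {m t : ℝ} {p₀ p₁ : ℝ → ℝ}

theorem monotone_interpolatedInverse (ht : t ∈ Icc (0 : ℝ) 1) :
    Monotone (interpolatedInverse p₀ p₁ t) := by
  intro q q' h
  have h1 : (0 : EReal) ≤ ((1 - t : ℝ) : EReal) := EReal.coe_nonneg.2 (sub_nonneg.2 ht.2)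
  have h0 : (0 : EReal) ≤ (t : EReal) := EReal.coe_nonneg.2 ht.1
  unfold interpolatedInverse
  have ha := monotone_inverseProfile p₀ h
  have hb := monotone_inverseProfile p₁ h
  gcongr

theorem min_le_of_lt_interpolatedInverse (ht : t ∈ Icc (0 : ℝ) 1) {q z : ℝ}
    (h : (z : EReal) < interpolatedInverse p₀ p₁ t q) : min (p₀ z) (p₁ z) ≤ q := by
  by_contra! hlt
  rw [lt_min_iff] at hlt
  exact (convexCombo_ereal_le ht (inverseProfile_le hlt.1) (inverseProfile_le hlt.2)).not_gt h

theorem lt_interpolatedInverse (hp₀ : p₀ ∈ increasingProfiles m) (hp₁ : p₁ ∈ increasingProfiles m)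
    (ht : t ∈ Icc (0 : ℝ) 1) {q z : ℝ} (h : max (p₀ z) (p₁ z) < q) :
    (z : EReal) < interpolatedInverse p₀ p₁ t q := by
  rw [max_lt_iff] at h
  exact lt_convexCombo_ereal ht (lt_inverseProfile hp₀.1.1 hp₀.2 h.1)
    (lt_inverseProfile hp₁.1.1 hp₁.2 h.2)

theorem bddBelow_interpolation (ht : t ∈ Icc (0 : ℝ) 1) (z : ℝ) :
    BddBelow {q : ℝ | (z : EReal) < interpolatedInverse p₀ p₁ t q} :=
  ⟨_, fun _ hq => min_le_of_lt_interpolatedInverse ht hq⟩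

theorem interpolation_nonempty (hp₀ : p₀ ∈ increasingProfiles m)
    (hp₁ : p₁ ∈ increasingProfiles m) (ht : t ∈ Icc (0 : ℝ) 1) (z : ℝ) :
    {q : ℝ | (z : EReal) < interpolatedInverse p₀ p₁ t q}.Nonempty :=
  ⟨max (p₀ z) (p₁ z) + 1, lt_interpolatedInverse hp₀ hp₁ ht (lt_add_one _)⟩

/-- With `interpolatedProfile_le_max`, this sandwich yields the range, the decay at both ends and
the pinning of the interpolant. -/
theorem min_le_interpolatedProfile (hp₀ : p₀ ∈ increasingProfiles m)
    (hp₁ : p₁ ∈ increasingProfiles m) (ht : t ∈ Icc (0 : ℝ) 1) (z : ℝ) :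
    min (p₀ z) (p₁ z) ≤ interpolatedProfile p₀ p₁ t z :=
  le_csInf (interpolation_nonempty hp₀ hp₁ ht z)
    fun _ hq => min_le_of_lt_interpolatedInverse ht hq

theorem interpolatedProfile_le_max (hp₀ : p₀ ∈ increasingProfiles m)
    (hp₁ : p₁ ∈ increasingProfiles m) (ht : t ∈ Icc (0 : ℝ) 1) (z : ℝ) :
    interpolatedProfile p₀ p₁ t z ≤ max (p₀ z) (p₁ z) :=
  le_of_forall_gt_imp_ge_of_dense fun _ hq =>
    csInf_le (bddBelow_interpolation ht z) (lt_interpolatedInverse hp₀ hp₁ ht hq)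

theorem isProfileInverse_interpolatedProfile (hp₀ : p₀ ∈ increasingProfiles m)
    (hp₁ : p₁ ∈ increasingProfiles m) (ht : t ∈ Icc (0 : ℝ) 1) :
    IsProfileInverse m (interpolatedProfile p₀ p₁ t) (fun q =>
      (1 - t) * (inverseProfile p₀ q).toReal + t * (inverseProfile p₁ q).toReal) := by
  have hcoe : ∀ q ∈ Ioo 0 m, interpolatedInverse p₀ p₁ t q = (((1 - t) *
      (inverseProfile p₀ q).toReal + t * (inverseProfile p₁ q).toReal : ℝ) : EReal) := by
    intro q hq
    rw [interpolatedInverse, inverseProfile_eq_coe hp₀ hq, inverseProfile_eq_coe hp₁ hq,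
      ← EReal.coe_mul, ← EReal.coe_mul, ← EReal.coe_add, EReal.toReal_coe, EReal.toReal_coe]
  refine ⟨((isProfileInverse_toReal hp₀).measurable.const_mul _).add
    ((isProfileInverse_toReal hp₁).measurable.const_mul _), fun q hq z h => ?_, fun q hq z h => ?_⟩
  · have := notMem_of_lt_csInf h (bddBelow_interpolation ht z)
    rw [mem_ofPred_eq, not_lt, hcoe q hq] at this
    exact EReal.coe_le_coe_iff.1 this
  · obtain ⟨q', hq', hlt⟩ := exists_lt_of_csInf_lt (interpolation_nonempty hp₀ hp₁ ht z) h
    have := lt_of_lt_of_le hq' (monotone_interpolatedInverse ht hlt.le)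
    rw [hcoe q hq] at this
    exact EReal.coe_lt_coe_iff.1 this

theorem abs_le_add_of_between {x a b : ℝ} (h1 : min a b ≤ x) (h2 : x ≤ max a b) :
    |x| ≤ |a| + |b| := by
  have := abs_le_max_abs_abs h1 h2
  refine this.trans (max_le ?_ ?_)
  · rcases min_choice a b with h | h <;> rw [h] <;> linarith [abs_nonneg a, abs_nonneg b]
  · rcases max_choice a b with h | h <;> rw [h] <;> linarith [abs_nonneg a, abs_nonneg b]

theorem interpolatedProfile_mem_increasingProfiles (hp₀ : p₀ ∈ increasingProfiles m)
    (hp₁ : p₁ ∈ increasingProfiles m) (ht : t ∈ Icc (0 : ℝ) 1) :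
    interpolatedProfile p₀ p₁ t ∈ increasingProfiles m := by
  have hmin := min_le_interpolatedProfile hp₀ hp₁ ht
  have hmax := interpolatedProfile_le_max hp₀ hp₁ ht
  have hinv := isProfileInverse_interpolatedProfile hp₀ hp₁ ht
  have h0 : ∀ z, 0 ≤ interpolatedProfile p₀ p₁ t z := fun z =>
    (le_min (hp₀.1.2.1 z) (hp₁.1.2.1 z)).trans (hmin z)
  have hm : ∀ z, interpolatedProfile p₀ p₁ t z ≤ m := fun z => (hmax z).trans
    (max_le (le_of_mem_increasingProfiles hp₀ z) (le_of_mem_increasingProfiles hp₁ z))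
  have hstrict : StrictMonoOn (fun q => (1 - t) * (inverseProfile p₀ q).toReal +
      t * (inverseProfile p₁ q).toReal) (Ioo 0 m) := by
    intro q hq q' hq' hlt
    have h1 := (isProfileInverse_toReal hp₀).strictMonoOn hp₀.1.1 hq hq' hlt
    have h2 := (isProfileInverse_toReal hp₁).strictMonoOn hp₁.1.1 hq hq' hlt
    simp only at h1 h2 ⊢
    have := sub_nonneg.2 ht.2
    rcases ht.1.eq_or_lt with h | h
    · rw [← h]; linarith
    · nlinarith
  refine ⟨⟨hinv.continuous hstrict h0 hm, h0, ?_, ?_⟩, hinv.monotone h0 hm⟩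
  · have hlim := hp₀.1.2.2.1.abs.add hp₁.1.2.2.1.abs
    rw [abs_zero, add_zero] at hlim
    refine squeeze_zero_norm (fun z => ?_) hlim
    rw [Real.norm_eq_abs, abs_mul, abs_mul, abs_mul, ← mul_add]
    exact mul_le_mul_of_nonneg_left (abs_le_add_of_between (hmin z) (hmax z)) (abs_nonneg z)
  · have hlim := hp₀.1.2.2.2.abs.add hp₁.1.2.2.2.abs
    rw [abs_zero, add_zero] at hlim
    refine squeeze_zero_norm (fun z => ?_) hlim
    rw [Real.norm_eq_abs, abs_mul, abs_mul, abs_mul, ← mul_add]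
    refine mul_le_mul_of_nonneg_left (abs_le_add_of_between ?_ ?_) (abs_nonneg z)
    · rw [min_sub_sub_right]; linarith [hmin z]
    · rw [max_sub_sub_right]; linarith [hmax z]

theorem pos_of_mem_strictProfiles {p : ℝ → ℝ} (hp : p ∈ strictProfiles m) (z : ℝ) : 0 < p z :=
  (hp.1.2.1 (z - 1)).trans_lt (hp.2 (sub_one_lt z))

theorem lt_of_mem_strictProfiles {p : ℝ → ℝ} (hp : p ∈ strictProfiles m) (z : ℝ) : p z < m :=
  (hp.2 (lt_add_one z)).trans_le (le_of_mem_increasingProfiles (strictProfiles_subset hp) _)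

theorem interpolatedProfile_mem_pinnedProfiles (hp₀ : p₀ ∈ pinnedProfiles m)
    (hp₁ : p₁ ∈ pinnedProfiles m) (ht : t ∈ Icc (0 : ℝ) 1) :
    interpolatedProfile p₀ p₁ t ∈ pinnedProfiles m := by
  have hi₀ := strictProfiles_subset hp₀.1
  have hi₁ := strictProfiles_subset hp₁.1
  have hmin := min_le_interpolatedProfile hi₀ hi₁ ht
  have hmax := interpolatedProfile_le_max hi₀ hi₁ ht
  refine ⟨⟨(interpolatedProfile_mem_increasingProfiles hi₀ hi₁ ht).1, ?_⟩, ?_⟩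
  · refine (isProfileInverse_interpolatedProfile hi₀ hi₁ ht).strictMono ?_ (fun z => ?_) fun z => ?_
    · exact (((isProfileInverse_toReal hi₀).continuousOn hi₀.1.1 hp₀.1.2).const_mul _).add
        (((isProfileInverse_toReal hi₁).continuousOn hi₁.1.1 hp₁.1.2).const_mul _)
    · exact (lt_min (pos_of_mem_strictProfiles hp₀.1 z)
        (pos_of_mem_strictProfiles hp₁.1 z)).trans_le (hmin z)
    · exact (hmax z).trans_lt (max_lt (lt_of_mem_strictProfiles hp₀.1 z)
        (lt_of_mem_strictProfiles hp₁.1 z))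
  · have h1 := hmin 0
    have h2 := hmax 0
    rw [hp₀.2, hp₁.2, min_self] at h1
    rw [hp₀.2, hp₁.2, max_self] at h2
    exact le_antisymm h2 h1

end Interpolation

/-! ### Integration over levels. -/

section Level

variable {m : ℝ} {p Z : ℝ → ℝ}

/-- A profile is the distribution function of its inverse. -/
theorem IsProfileInverse.volume_setOf_le (h : IsProfileInverse m p Z)
    (hm : ∀ z, p z ≤ m) (z : ℝ) :
    volume.restrict (Ioo 0 m) {q | Z q ≤ z} = ENNReal.ofReal (p z) := by
  rw [Measure.restrict_apply (measurableSet_le h.measurable measurable_const)]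
  refine le_antisymm ?_ ?_
  · calc volume ({q | Z q ≤ z} ∩ Ioo 0 m) ≤ volume (Ioc 0 (p z)) :=
          measure_mono fun q hq => ⟨hq.2.1, h.le_apply hq.2 hq.1⟩
      _ = ENNReal.ofReal (p z) := by simp
  · calc ENNReal.ofReal (p z) = volume (Ioo 0 (p z)) := by simp
      _ ≤ volume ({q | Z q ≤ z} ∩ Ioo 0 m) := by
          refine measure_mono fun q hq => ?_
          have hq' : q ∈ Ioo 0 m := ⟨hq.1, hq.2.trans_le (hm z)⟩
          exact ⟨h.le_of_lt q hq' z hq.2, hq'⟩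

theorem IsProfileInverse.abs_le (h : IsProfileInverse m p Z) (hc : Continuous p) {C₁ C₂ : ℝ}
    (hC₁ : ∀ z ≤ 0, -z * p z ≤ C₁) (hC₂ : ∀ z, 0 ≤ z → z * (m - p z) ≤ C₂)
    (h1 : 0 ≤ C₁) (h2 : 0 ≤ C₂) {q : ℝ} (hq : q ∈ Ioo 0 m) :
    |Z q| ≤ C₁ / q + C₂ / (m - q) := by
  have hmq : 0 < m - q := sub_pos.2 hq.2
  have hpq := h.apply_inverse hc hq
  have e1 : 0 ≤ C₁ / q := div_nonneg h1 hq.1.le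
  have e2 : 0 ≤ C₂ / (m - q) := div_nonneg h2 hmq.le
  rcases le_total (Z q) 0 with hz | hz
  · rw [abs_of_nonpos hz]
    have := hC₁ _ hz
    rw [hpq, ← le_div_iff₀ hq.1] at this
    linarith
  · rw [abs_of_nonneg hz]
    have := hC₂ _ hz
    rw [hpq, ← le_div_iff₀ hmq] at this
    linarith

/-- Integration over the level sets: `∫ G(p(z)) dz = -∫ G'(q) z(q) dq`. -/
theorem integral_comp_eq_neg_integral_inverse {G g : ℝ → ℝ} (h : IsProfileInverse m p Z)
    (h0 : ∀ z, 0 ≤ p z) (hm : ∀ z, p z ≤ m) (hG : ∀ x, HasDerivAt G (g x) x)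
    (hg : Continuous g) (hG0 : G 0 = 0) (hGm : G m = 0)
    (hint : IntegrableOn (fun q => g q * Z q) (Ioo 0 m)) :
    Integrable (fun z => G (p z)) ∧ ∫ z, G (p z) = -∫ q in Ioo 0 m, g q * Z q := by
  set μ : Measure ℝ := volume.restrict (Ioo 0 m)
  -- Signed kernel for Fubini: its `z`-integral is `-Z q`. Against `g` over levels it gives `G (p
  -- z)` for `z < 0` and `G (p z) - G m` for `z ≥ 0`, which agree in form since `G m = 0`.
  let K : ℝ × ℝ → ℝ := fun w =>
    {w : ℝ × ℝ | Z w.1 ≤ w.2 ∧ w.2 < 0}.indicator 1 w - {w | 0 ≤ w.2 ∧ w.2 < Z w.1}.indicator 1 w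
  have hZm : Measurable fun w : ℝ × ℝ => Z w.1 := h.measurable.comp measurable_fst
  have hm1 : MeasurableSet {w : ℝ × ℝ | Z w.1 ≤ w.2 ∧ w.2 < 0} :=
    (measurableSet_le hZm measurable_snd).inter (measurableSet_lt measurable_snd measurable_const)
  have hm2 : MeasurableSet {w : ℝ × ℝ | 0 ≤ w.2 ∧ w.2 < Z w.1} :=
    (measurableSet_le measurable_const measurable_snd).inter (measurableSet_lt measurable_snd hZm)
  have hKm : Measurable K := (measurable_one.indicator hm1).sub (measurable_one.indicator hm2)
  have hKq : ∀ q, (fun z => K (q, z)) =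
      fun z => (Ico (Z q) 0).indicator (1 : ℝ → ℝ) z - (Ico 0 (Z q)).indicator (1 : ℝ → ℝ) z := by
    intro q; rfl
  have hico : ∀ a b : ℝ, Integrable ((Ico a b).indicator (1 : ℝ → ℝ)) := fun a b =>
    (integrable_indicator_iff measurableSet_Ico).2 (integrableOn_const (by simp))
  have hico' : ∀ a b : ℝ, ∫ z, (Ico a b).indicator (1 : ℝ → ℝ) z = max (b - a) 0 := fun a b => by
    rw [integral_indicator_one measurableSet_Ico, Real.volume_real_Ico]
  have hKint : ∀ q, ∫ z, K (q, z) = -Z q := by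
    intro q
    rw [hKq, integral_sub (hico _ _) (hico _ _), hico', hico']
    rcases le_total (Z q) 0 with hz | hz
    · rw [max_eq_left (by linarith), max_eq_right (by linarith)]; ring
    · rw [max_eq_right (by linarith), max_eq_left (by linarith)]; ring
  have hKnorm : ∀ q, ∫ z, ‖K (q, z)‖ = |Z q| := by
    intro q
    have : (fun z => ‖K (q, z)‖) = fun z =>
        (Ico (Z q) 0).indicator (1 : ℝ → ℝ) z + (Ico 0 (Z q)).indicator (1 : ℝ → ℝ) z := by
      funext z
      simp only [K, indicator, mem_ofPred_eq, mem_Ico, Pi.one_apply]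
      split_ifs with h1 h2 h2 <;> first | (exfalso; linarith [h1.2, h2.1]) | norm_num
    rw [this, integral_add (hico _ _) (hico _ _), hico', hico']
    rcases le_total (Z q) 0 with hz | hz
    · rw [max_eq_left (by linarith), max_eq_right (by linarith), abs_of_nonpos hz]; ring
    · rw [max_eq_right (by linarith), max_eq_left (by linarith), abs_of_nonneg hz]; ring
  have hH : Integrable (fun w : ℝ × ℝ => g w.1 * K w) (μ.prod volume) := by
    have hmeas : Measurable fun w : ℝ × ℝ => g w.1 * K w :=
      (hg.measurable.comp measurable_fst).mul hKm
    rw [integrable_prod_iff hmeas.aestronglyMeasurable]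
    refine ⟨ae_of_all _ fun q => ?_, ?_⟩
    · refine Integrable.const_mul ?_ (g q)
      rw [hKq]
      exact (hico _ _).sub (hico _ _)
    · refine hint.norm.congr (ae_of_all _ fun q => ?_)
      simp only [norm_mul]
      rw [integral_const_mul, hKnorm, Real.norm_eq_abs (Z q)]
  have hgint : ∀ a b : ℝ, IntervalIntegrable g volume a b := fun a b => hg.intervalIntegrable a b
  have hftc : ∀ b, 0 ≤ b → ∫ q in Ioo 0 b, g q = G b := by
    intro b hb
    rw [← integral_Ioc_eq_integral_Ioo, ← intervalIntegral.integral_of_le hb,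
      intervalIntegral.integral_eq_sub_of_hasDerivAt (fun x _ => hG x) (hgint 0 b), hG0, sub_zero]
  have hm0 : 0 ≤ m := (h0 0).trans (hm 0)
  have hslice : ∀ z, ∫ q, g q * K (q, z) ∂μ = G (p z) := by
    intro z
    have hgi : IntegrableOn g (Ioo 0 m) :=
      ((intervalIntegrable_iff_integrableOn_Ioo_of_le hm0).1 (hgint 0 m))
    have hae : (fun q => g q * K (q, z)) =ᵐ[μ] fun q =>
        (Ioo 0 (p z)).indicator g q - if 0 ≤ z then g q else 0 := by
      -- `Z q ≤ z` and `q < p z` can differ only at `q = p z`, a null set.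
      have hne : ∀ᵐ q ∂μ, q ≠ p z := ae_restrict_of_ae (Measure.ae_ne volume (p z))
      filter_upwards [hne, ae_restrict_mem measurableSet_Ioo] with q hqne hq
      have hiff : Z q ≤ z ↔ q < p z :=
        ⟨fun hle => lt_of_le_of_ne (h.le_apply hq hle) hqne, h.le_of_lt q hq z⟩
      simp only [K, indicator, mem_ofPred_eq, mem_Ioo, hq.1, true_and, ← hiff, Pi.one_apply,
        ← not_le]
      by_cases ha : Z q ≤ z <;> by_cases hb : 0 ≤ z <;> simp [ha, hb]
    rw [integral_congr_ae hae, integral_sub]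
    · rw [integral_indicator measurableSet_Ioo, Measure.restrict_restrict measurableSet_Ioo,
        inter_eq_left.2 (Ioo_subset_Ioo_right (hm z)), hftc _ (h0 z)]
      split_ifs
      · rw [hftc m hm0, hGm, sub_zero]
      · simp
    · exact hgi.indicator measurableSet_Ioo
    · split_ifs
      · exact hgi
      · exact integrable_zero _ _ _
  have h1 := hH.integral_prod_right
  simp only [hslice] at h1
  refine ⟨h1, ?_⟩
  have h2 := integral_prod_symm _ hH
  rw [integral_prod _ hH] at h2
  simp only [hslice, integral_const_mul, hKint] at h2
  rw [← h2, ← integral_neg]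
  simp only [mul_neg]

end Level

/-! ### The interaction term as a mean displacement of maxima. -/

section Gap

variable {m : ℝ} {p Z : ℝ → ℝ}

/-- Lebesgue measure on `(0, m) × (0, 1]`, the space of pairs of a level and a shift. -/
noncomputable abbrev shiftMeasure (m : ℝ) : Measure (ℝ × ℝ) :=
  (volume.restrict (Ioo 0 m)).prod (volume.restrict (Ioc 0 1))

theorem shiftMeasure_setOf_level_le (h : IsProfileInverse m p Z)
    (hm : ∀ z, p z ≤ m) (z : ℝ) :
    shiftMeasure m {y | Z y.1 ≤ z} = ENNReal.ofReal (p z) := by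
  have : {y : ℝ × ℝ | Z y.1 ≤ z} = {q | Z q ≤ z} ×ˢ univ := by ext; simp
  rw [this, Measure.prod_prod, h.volume_setOf_le hm]
  simp

theorem shiftMeasure_setOf_shifted_le (h : IsProfileInverse m p Z) (hc : Continuous p)
    (h0 : ∀ z, 0 ≤ p z) (hm : ∀ z, p z ≤ m) (z : ℝ) :
    shiftMeasure m {y | Z y.1 - y.2 ≤ z} = ENNReal.ofReal (∫ u in (0 : ℝ)..1, p (z + u)) := by
  have hcz : Continuous fun u => p (z + u) := hc.comp (continuous_const.add continuous_id)
  have hmeas : Measurable fun y : ℝ × ℝ => Z y.1 - y.2 :=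
    (h.measurable.comp measurable_fst).sub measurable_snd
  rw [Measure.prod_apply_symm (measurableSet_le hmeas measurable_const),
    intervalIntegral.integral_of_le zero_le_one,
    ofReal_integral_eq_lintegral_ofReal
      ((intervalIntegrable_iff_integrableOn_Ioc_of_le zero_le_one).1 (hcz.intervalIntegrable 0 1))
      (ae_of_all _ fun u => h0 _)]
  refine lintegral_congr fun u => ?_
  rw [← h.volume_setOf_le hm]
  congr 1
  ext q
  simp

theorem ae_mem_of_shiftMeasure {l : ℕ} :
    ∀ᵐ x ∂Measure.pi fun _ : Fin l => shiftMeasure m,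
      ∀ i, (x i).1 ∈ Ioo 0 m ∧ (x i).2 ∈ Ioc (0 : ℝ) 1 := by
  have hy : ∀ᵐ y ∂shiftMeasure m, y.1 ∈ Ioo 0 m ∧ y.2 ∈ Ioc (0 : ℝ) 1 := by
    rw [shiftMeasure, Measure.prod_restrict]
    filter_upwards [ae_restrict_mem (measurableSet_Ioo.prod measurableSet_Ioc)] with y hy using hy
  exact ae_all_iff.2 fun i => (Measure.tendsto_eval_ae_ae (μ := fun _ : Fin l => shiftMeasure m)
    (i := i)).eventually hy

variable {l : ℕ} [NeZero l]

/-- The largest of the positions of the levels. -/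
noncomputable def maxLevel (Z : ℝ → ℝ) (x : Fin l → ℝ × ℝ) : ℝ :=
  Finset.univ.sup' Finset.univ_nonempty fun i => Z (x i).1

/-- The largest of the shifted positions of the levels. -/
noncomputable def maxShifted (Z : ℝ → ℝ) (x : Fin l → ℝ × ℝ) : ℝ :=
  Finset.univ.sup' Finset.univ_nonempty fun i => Z (x i).1 - (x i).2

theorem measurable_maxLevel (hZ : Measurable Z) : Measurable (maxLevel (l := l) Z) := by
  have := Finset.measurable_sup' (s := (Finset.univ : Finset (Fin l))) Finset.univ_nonempty
    (f := fun i (x : Fin l → ℝ × ℝ) => Z (x i).1)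
    fun i _ => hZ.comp (measurable_fst.comp (measurable_pi_apply i))
  convert this using 1
  ext x
  simp [maxLevel]

theorem measurable_maxShifted (hZ : Measurable Z) : Measurable (maxShifted (l := l) Z) := by
  have := Finset.measurable_sup' (s := (Finset.univ : Finset (Fin l))) Finset.univ_nonempty
    (f := fun i (x : Fin l → ℝ × ℝ) => Z (x i).1 - (x i).2)
    fun i _ => (hZ.comp (measurable_fst.comp (measurable_pi_apply i))).sub
      (measurable_snd.comp (measurable_pi_apply i))
  convert this using 1
  ext x
  simp [maxShifted]

theorem maxShifted_le_maxLevel {x : Fin l → ℝ × ℝ} (hx : ∀ i, (x i).2 ∈ Ioc (0 : ℝ) 1) :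
    maxShifted Z x ≤ maxLevel Z x :=
  Finset.sup'_mono_fun fun i _ => by linarith [(hx i).1]

theorem maxLevel_le_maxShifted_add_one {x : Fin l → ℝ × ℝ} (hx : ∀ i, (x i).2 ∈ Ioc (0 : ℝ) 1) :
    maxLevel Z x ≤ maxShifted Z x + 1 := by
  refine Finset.sup'_le _ _ fun i hi => ?_
  have : Z (x i).1 - (x i).2 ≤ maxShifted Z x :=
    Finset.le_sup' (fun i => Z (x i).1 - (x i).2) hi
  linarith [(hx i).2]

theorem integrable_maxLevel_sub_maxShifted (hZ : Measurable Z) :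
    Integrable (fun x => maxLevel Z x - maxShifted Z x)
      (Measure.pi fun _ : Fin l => shiftMeasure m) := by
  refine Integrable.mono' (integrable_const 1)
    ((measurable_maxLevel hZ).sub (measurable_maxShifted hZ)).aestronglyMeasurable ?_
  filter_upwards [ae_mem_of_shiftMeasure] with x hx
  have h1 := maxShifted_le_maxLevel (Z := Z) fun i => (hx i).2
  have h2 := maxLevel_le_maxShifted_add_one (Z := Z) fun i => (hx i).2
  rw [Real.norm_eq_abs, abs_le]
  constructor <;> linarith

/-- The excess of the averaged power over the local one, as an average over levels and shifts of
the displacement of the largest position. -/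
theorem integral_average_pow_sub_pow (h : IsProfileInverse m p Z) (hc : Continuous p)
    (h0 : ∀ z, 0 ≤ p z) (hm : ∀ z, p z ≤ m) :
    Integrable (fun z => (∫ u in (0 : ℝ)..1, p (z + u)) ^ l - p z ^ l) ∧
      ∫ z, ((∫ u in (0 : ℝ)..1, p (z + u)) ^ l - p z ^ l) =
        ∫ x, (maxLevel Z x - maxShifted Z x) ∂Measure.pi fun _ : Fin l => shiftMeasure m := by
  set μ := Measure.pi fun _ : Fin l => shiftMeasure m
  have hA := measurable_maxLevel (l := l) h.measurable
  have hB := measurable_maxShifted (l := l) h.measurable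
  -- The region between the two maxima is measured in both orders: its sections in `z` have length
  -- at most `1`, its sections in `x` have measure `avg^l - p^l`.
  let T : Set ((Fin l → ℝ × ℝ) × ℝ) := {w | maxShifted Z w.1 ≤ w.2 ∧ w.2 < maxLevel Z w.1}
  have hT : MeasurableSet T :=
    (measurableSet_le (hB.comp measurable_fst) measurable_snd).inter
      (measurableSet_lt measurable_snd (hA.comp measurable_fst))
  have hTfin : (μ.prod volume) T < ⊤ := by
    rw [Measure.prod_apply hT]
    calc ∫⁻ x, volume (Prod.mk x ⁻¹' T) ∂μ ≤ ∫⁻ _, 1 ∂μ := by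
          refine lintegral_mono_ae ?_
          filter_upwards [ae_mem_of_shiftMeasure] with x hx
          have : Prod.mk x ⁻¹' T = Ico (maxShifted Z x) (maxLevel Z x) := rfl
          rw [this, Real.volume_Ico]
          refine ENNReal.ofReal_le_one.2 ?_
          linarith [maxLevel_le_maxShifted_add_one (Z := Z) fun i => (hx i).2]
      _ < ⊤ := by rw [lintegral_one]; exact measure_lt_top _ _
  have hH : Integrable
      (T.indicator (1 : (Fin l → ℝ × ℝ) × ℝ → ℝ)) (μ.prod volume) :=
    (integrable_indicator_iff hT).2 (integrableOn_const hTfin.ne)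
  have hx : ∀ᵐ x ∂μ, ∫ z, T.indicator (1 : (Fin l → ℝ × ℝ) × ℝ → ℝ) (x, z) = maxLevel Z x - maxShifted Z x := by
    filter_upwards [ae_mem_of_shiftMeasure] with x hx
    have : (fun z => T.indicator (1 : (Fin l → ℝ × ℝ) × ℝ → ℝ) (x, z)) =
      (Ico (maxShifted Z x) (maxLevel Z x)).indicator 1 := rfl
    rw [this, integral_indicator_one measurableSet_Ico, Real.volume_real_Ico, max_eq_left]
    exact sub_nonneg.2 (maxShifted_le_maxLevel fun i => (hx i).2)
  -- A sublevel set of a maximum is a product box, whence the `l`-th power.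
  have hAz : ∀ z, μ.real {x | maxLevel Z x ≤ z} = p z ^ l := by
    intro z
    have : {x : Fin l → ℝ × ℝ | maxLevel Z x ≤ z} = univ.pi fun _ => {y | Z y.1 ≤ z} := by
      ext x; simp [maxLevel, Finset.sup'_le_iff]
    rw [Measure.real, this, Measure.pi_pi]
    simp [shiftMeasure_setOf_level_le h hm, h0 z]
  have hBz : ∀ z, μ.real {x | maxShifted Z x ≤ z} = (∫ u in (0 : ℝ)..1, p (z + u)) ^ l := by
    intro z
    have : {x : Fin l → ℝ × ℝ | maxShifted Z x ≤ z} = univ.pi fun _ => {y | Z y.1 - y.2 ≤ z} := by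
      ext x; simp only [maxShifted, Finset.sup'_le_iff, mem_ofPred_eq, mem_univ_pi, Finset.mem_univ,
        true_imp_iff]
    have hnn : 0 ≤ ∫ u in (0 : ℝ)..1, p (z + u) :=
      intervalIntegral.integral_nonneg zero_le_one fun u _ => h0 _
    rw [Measure.real, this, Measure.pi_pi]
    simp only [shiftMeasure_setOf_shifted_le h hc h0 hm, Finset.prod_const, Finset.card_univ,
      Fintype.card_fin, ENNReal.toReal_pow, ENNReal.toReal_ofReal hnn]
  have hz : ∀ z, ∫ x, T.indicator (1 : (Fin l → ℝ × ℝ) × ℝ → ℝ) (x, z) ∂μ =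
      (∫ u in (0 : ℝ)..1, p (z + u)) ^ l - p z ^ l := by
    intro z
    have hmA : MeasurableSet {x : Fin l → ℝ × ℝ | maxLevel Z x ≤ z} :=
      measurableSet_le hA measurable_const
    have hmB : MeasurableSet {x : Fin l → ℝ × ℝ | maxShifted Z x ≤ z} :=
      measurableSet_le hB measurable_const
    have : (fun x => T.indicator (1 : (Fin l → ℝ × ℝ) × ℝ → ℝ) (x, z)) =
        ({x | maxShifted Z x ≤ z} \ {x | maxLevel Z x ≤ z}).indicator 1 := by
      funext x
      simp [indicator, T]
    rw [this, integral_indicator_one (hmB.diff hmA), ← hAz, ← hBz,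
      ← measureReal_inter_add_sdiff (s := {x | maxShifted Z x ≤ z}) hmA]
    have hcongr : μ.real ({x | maxShifted Z x ≤ z} ∩ {x | maxLevel Z x ≤ z}) =
        μ.real {x | maxLevel Z x ≤ z} := by
      refine measureReal_congr ?_
      filter_upwards [ae_mem_of_shiftMeasure] with x hx
      have := maxShifted_le_maxLevel (Z := Z) fun i => (hx i).2
      exact propext ⟨fun h => h.2, fun h => ⟨this.trans h, h⟩⟩
    rw [hcongr]; ring
  have h1 := hH.integral_prod_right
  simp only [hz] at h1
  refine ⟨h1, ?_⟩
  have h2 := integral_prod_symm _ hH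
  rw [integral_prod _ hH, integral_congr_ae hx] at h2
  simp only [hz] at h2
  exact h2.symm

end Gap

/-! ### The potential as a functional of the inverse. -/

section Representation

variable {l r : ℕ} {p Z : ℝ → ℝ}

theorem integrableOn_singleDeriv_mul_inverse (hl : 2 ≤ l) (hr : 2 ≤ r)
    (hp : p ∈ increasingProfiles (pMAP l r)) (h : IsProfileInverse (pMAP l r) p Z) :
    IntegrableOn (fun q => singleDeriv l r (epsMAP l r) q * Z q) (Ioo 0 (pMAP l r)) := by
  have hε := (epsMAP_mem (l := l) (r := r) (by omega) hr).1
  have hm := (pMAP_mem (l := l) (r := r) (by omega) hr).1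
  have hd := singleDeriv_pMAP hl hr
  set ε := epsMAP l r
  set m := pMAP l r
  obtain ⟨C₁, h1, hC₁⟩ := exists_bound_left hp
  obtain ⟨C₂, h2, hC₂⟩ := exists_bound_right hp
  have hr' : (2 : ℝ) ≤ r := by exact_mod_cast hr
  set α := 1 / ((r : ℝ) - 1)
  have hα : 0 < α := by apply div_pos <;> linarith
  have hpow : IntegrableOn (fun q : ℝ => (m - q) ^ (α - 1)) (Ioo 0 m) := by
    have := (intervalIntegral.intervalIntegrable_rpow' (a := 0) (b := m) (r := α - 1)
      (by linarith)).comp_sub_left m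
    rw [sub_zero, sub_self] at this
    exact (intervalIntegrable_iff_integrableOn_Ioo_of_le hm.1).1 this.symm
  have hfin : volume (Ioo 0 m) ≠ ⊤ := by simp
  have hbound : IntegrableOn (fun q : ℝ => C₁ + C₂ * ((m - q) ^ (α - 1) + l)) (Ioo 0 m) :=
    (integrableOn_const hfin).add ((hpow.add (integrableOn_const hfin)).const_mul C₂)
  refine Integrable.mono' hbound
    ((continuous_singleDeriv hr ε).measurable.mul h.measurable).aestronglyMeasurable ?_
  filter_upwards [ae_restrict_mem measurableSet_Ioo] with q hq
  have hmq : 0 < m - q := sub_pos.2 hq.2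
  have hZ := h.abs_le hp.1.1 hC₁ hC₂ h1 h2 hq
  have b1 := abs_singleDeriv_le_self hl hr hε ⟨hq.1.le, hq.2.le.trans hm.2⟩
  have b2 := abs_singleDeriv_le hr hε hq.1.le hq.2.le hm.2 hd
  rw [Real.norm_eq_abs, abs_mul]
  have e1 : |singleDeriv l r ε q| * (C₁ / q) ≤ C₁ := by
    calc |singleDeriv l r ε q| * (C₁ / q) ≤ q * (C₁ / q) :=
          mul_le_mul_of_nonneg_right b1 (div_nonneg h1 hq.1.le)
      _ = C₁ := by field_simp [hq.1.ne']
  have e2 : |singleDeriv l r ε q| * (C₂ / (m - q)) ≤ C₂ * ((m - q) ^ (α - 1) + l) := by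
    calc |singleDeriv l r ε q| * (C₂ / (m - q))
        ≤ ((m - q) ^ α + l * (m - q)) * (C₂ / (m - q)) :=
          mul_le_mul_of_nonneg_right b2 (div_nonneg h2 hmq.le)
      _ = C₂ * ((m - q) ^ (α - 1) + l) := by
          rw [Real.rpow_sub_one hmq.ne']
          field_simp
  calc |singleDeriv l r ε q| * |Z q|
      ≤ |singleDeriv l r ε q| * (C₁ / q + C₂ / (m - q)) :=
        mul_le_mul_of_nonneg_left hZ (abs_nonneg _)
    _ ≤ C₁ + C₂ * ((m - q) ^ (α - 1) + l) := by rw [mul_add]; linarith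

theorem potential_eq_integral_inverse [NeZero l] (hl : 2 ≤ l) (hr : 2 ≤ r)
    (hp : p ∈ increasingProfiles (pMAP l r)) (h : IsProfileInverse (pMAP l r) p Z) :
    Integrable (potentialDensity l r (epsMAP l r) p) ∧
      potential l r (epsMAP l r) p =
        -(∫ q in Ioo 0 (pMAP l r), singleDeriv l r (epsMAP l r) q * Z q) -
          epsMAP l r / l * ∫ x, (maxLevel Z x - maxShifted Z x)
            ∂Measure.pi fun _ : Fin l => shiftMeasure (pMAP l r) := by
  obtain ⟨i1, e1⟩ := integral_comp_eq_neg_integral_inverse h hp.1.2.1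
    (le_of_mem_increasingProfiles hp) (hasDerivAt_singlePotential (by omega) hr (epsMAP l r))
    (continuous_singleDeriv hr _) (singlePotential_zero_right (by omega) _)
    (pMAP_mem (by omega) hr).2 (integrableOn_singleDeriv_mul_inverse hl hr hp h)
  obtain ⟨i2, e2⟩ := integral_average_pow_sub_pow (l := l) h hp.1.1 hp.1.2.1
    (le_of_mem_increasingProfiles hp)
  have hdens : potentialDensity l r (epsMAP l r) p = fun z =>
      singlePotential l r (epsMAP l r) (p z) -
        epsMAP l r / l * ((∫ u in (0 : ℝ)..1, p (z + u)) ^ l - p z ^ l) := by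
    funext z
    simp only [potentialDensity, singlePotential]
    ring
  have i3 := i2.const_mul (epsMAP l r / l)
  refine ⟨hdens ▸ i1.sub i3, ?_⟩
  rw [potential, hdens, integral_sub i1 i3, e1, integral_const_mul, e2]

end Representation

/-! ### Concavity of the mean displacement. -/

section Convexity

variable {m t : ℝ} {Z₀ Z₁ : ℝ → ℝ} {l : ℕ} [NeZero l]

theorem maxLevel_eq_of_forall_le {Z : ℝ → ℝ} (hZ : MonotoneOn Z (Ioo 0 m)) {x : Fin l → ℝ × ℝ}
    (hx : ∀ i, (x i).1 ∈ Ioo 0 m) {j : Fin l} (hj : ∀ i, (x i).1 ≤ (x j).1) :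
    maxLevel Z x = Z (x j).1 :=
  le_antisymm (Finset.sup'_le _ _ fun i _ => hZ (hx i) (hx j) (hj i))
    (Finset.le_sup' (fun i => Z (x i).1) (Finset.mem_univ j))

/-- The index of the largest level maximizes `Z₀`, `Z₁` and their combination at once. -/
theorem maxLevel_convexCombo (h₀ : MonotoneOn Z₀ (Ioo 0 m)) (h₁ : MonotoneOn Z₁ (Ioo 0 m))
    (ht : t ∈ Icc (0 : ℝ) 1) {x : Fin l → ℝ × ℝ} (hx : ∀ i, (x i).1 ∈ Ioo 0 m) :
    maxLevel (fun q => (1 - t) * Z₀ q + t * Z₁ q) x =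
      (1 - t) * maxLevel Z₀ x + t * maxLevel Z₁ x := by
  obtain ⟨j, hj⟩ := Finite.exists_max fun i => (x i).1
  have h : MonotoneOn (fun q => (1 - t) * Z₀ q + t * Z₁ q) (Ioo 0 m) := fun a ha b hb hab =>
    add_le_add (mul_le_mul_of_nonneg_left (h₀ ha hb hab) (sub_nonneg.2 ht.2))
      (mul_le_mul_of_nonneg_left (h₁ ha hb hab) ht.1)
  rw [maxLevel_eq_of_forall_le h hx hj, maxLevel_eq_of_forall_le h₀ hx hj,
    maxLevel_eq_of_forall_le h₁ hx hj]

theorem le_maxShifted (Z : ℝ → ℝ) (x : Fin l → ℝ × ℝ) (i : Fin l) :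
    Z (x i).1 - (x i).2 ≤ maxShifted Z x :=
  Finset.le_sup' (fun i => Z (x i).1 - (x i).2) (Finset.mem_univ i)

theorem maxShifted_convexCombo_le (ht : t ∈ Icc (0 : ℝ) 1) (x : Fin l → ℝ × ℝ) :
    maxShifted (fun q => (1 - t) * Z₀ q + t * Z₁ q) x ≤
      (1 - t) * maxShifted Z₀ x + t * maxShifted Z₁ x := by
  refine Finset.sup'_le _ _ fun i _ => ?_
  have h0 := mul_le_mul_of_nonneg_left (le_maxShifted Z₀ x i) (sub_nonneg.2 ht.2)
  have h1 := mul_le_mul_of_nonneg_left (le_maxShifted Z₁ x i) ht.1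
  linarith

/-- Index `j` is not maximal for `Z₀`, and no other index is maximal for `Z₁`, so no index attains
both maxima. -/
theorem maxShifted_convexCombo_lt (ht : t ∈ Ioo (0 : ℝ) 1) {x : Fin l → ℝ × ℝ} {c₀ c₁ : ℝ}
    {j k : Fin l} (hkj : k ≠ j)
    (h : ∀ i ≠ j, c₀ < Z₀ (x i).1 - (x i).2 ∧ Z₁ (x i).1 - (x i).2 < c₁)
    (hj : Z₀ (x j).1 - (x j).2 < c₀ ∧ c₁ < Z₁ (x j).1 - (x j).2) :
    maxShifted (fun q => (1 - t) * Z₀ q + t * Z₁ q) x <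
      (1 - t) * maxShifted Z₀ x + t * maxShifted Z₁ x := by
  have ht' : 0 < 1 - t := sub_pos.2 ht.2
  refine (Finset.sup'_lt_iff _).2 fun i _ => ?_
  by_cases hi : i = j
  · subst hi
    have h0 := mul_lt_mul_of_pos_left (hj.1.trans ((h k hkj).1.trans_le (le_maxShifted Z₀ x k))) ht'
    have h1 := mul_le_mul_of_nonneg_left (le_maxShifted Z₁ x i) ht.1.le
    linarith
  · have h0 := mul_le_mul_of_nonneg_left (le_maxShifted Z₀ x i) ht'.le
    have h1 := mul_lt_mul_of_pos_left ((h i hi).2.trans (hj.2.trans_le (le_maxShifted Z₁ x j))) ht.1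
    linarith

theorem sub_maxShifted_concave (h₀ : MonotoneOn Z₀ (Ioo 0 m)) (h₁ : MonotoneOn Z₁ (Ioo 0 m))
    (ht : t ∈ Icc (0 : ℝ) 1) {x : Fin l → ℝ × ℝ} (hx : ∀ i, (x i).1 ∈ Ioo 0 m) :
    (1 - t) * (maxLevel Z₀ x - maxShifted Z₀ x) + t * (maxLevel Z₁ x - maxShifted Z₁ x) ≤
      maxLevel (fun q => (1 - t) * Z₀ q + t * Z₁ q) x -
        maxShifted (fun q => (1 - t) * Z₀ q + t * Z₁ q) x := by
  rw [maxLevel_convexCombo h₀ h₁ ht hx]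
  linarith [maxShifted_convexCombo_le (Z₀ := Z₀) (Z₁ := Z₁) ht x]

/-- If the difference of two inverses is not constant, then some shifted level is ahead of another one for `Z₀`
and behind it for `Z₁`. -/
theorem exists_crossing (h₀ : ContinuousOn Z₀ (Ioo 0 m)) (h₁ : ContinuousOn Z₁ (Ioo 0 m))
    {a b : ℝ} (ha : a ∈ Ioo 0 m) (hb : b ∈ Ioo 0 m) (hab : Z₀ a - Z₁ a ≠ Z₀ b - Z₁ b) :
    ∃ q ∈ Ioo 0 m, ∃ q' ∈ Ioo 0 m, ∃ u ∈ Ioo (0 : ℝ) 1, ∃ u' ∈ Ioo (0 : ℝ) 1,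
      Z₀ q' - u' < Z₀ q - u ∧ Z₁ q - u < Z₁ q' - u' := by
  -- Otherwise `Z₀ - Z₁` would be locally constant on a connected interval.
  have hclose : ∃ q ∈ Ioo 0 m, ∃ q' ∈ Ioo 0 m, |Z₀ q - Z₀ q'| < 1 ∧ |Z₁ q - Z₁ q'| < 1 ∧
      Z₁ q - Z₁ q' < Z₀ q - Z₀ q' := by
    by_contra! hcon
    refine hab (isPreconnected_Ioo.induction₂ (fun q q' => Z₀ q - Z₁ q = Z₀ q' - Z₁ q')
      (fun q hq => ?_) (fun _ _ _ _ _ _ h h' => h.trans h') (fun _ _ _ _ h => h.symm) ha hb)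
    filter_upwards [self_mem_nhdsWithin, (h₀ q hq).eventually (Metric.ball_mem_nhds _ one_pos),
      (h₁ q hq).eventually (Metric.ball_mem_nhds _ one_pos)] with q' hq' hd₀ hd₁
    rw [Real.dist_eq] at hd₀ hd₁
    have e1 := hcon q' hq' q hq hd₀ hd₁
    rw [abs_sub_comm] at hd₀ hd₁
    have e2 := hcon q hq q' hq' hd₀ hd₁
    linarith
  obtain ⟨q, hq, q', hq', hd₀, hd₁, hlt⟩ := hclose
  rw [abs_lt] at hd₀ hd₁
  obtain ⟨d, hd, hd'⟩ := exists_between hlt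
  -- The shifts differ by `d`, which separates the two increments; `|d| < 1` keeps both in `(0, 1)`.
  refine ⟨q, hq, q', hq', 1 / 2 + d / 2, ⟨by linarith, by linarith⟩, 1 / 2 - d / 2,
    ⟨by linarith, by linarith⟩, by linarith, by linarith⟩

theorem shiftMeasure_pos_of_continuousOn {f g : ℝ × ℝ → ℝ}
    (hf : ContinuousOn f (Ioo 0 m ×ˢ Ioo 0 1)) (hg : ContinuousOn g (Ioo 0 m ×ˢ Ioo 0 1))
    {y : ℝ × ℝ} (hy : y ∈ Ioo 0 m ×ˢ Ioo (0 : ℝ) 1) (hfy : f y < 0) (hgy : g y < 0) :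
    0 < shiftMeasure m {y | f y < 0 ∧ g y < 0} := by
  have hopen : IsOpen (Ioo 0 m ×ˢ Ioo (0 : ℝ) 1) := isOpen_Ioo.prod isOpen_Ioo
  have hV : IsOpen ((Ioo 0 m ×ˢ Ioo (0 : ℝ) 1 ∩ f ⁻¹' Iio 0) ∩
      (Ioo 0 m ×ˢ Ioo (0 : ℝ) 1 ∩ g ⁻¹' Iio 0)) :=
    (hf.isOpen_inter_preimage hopen isOpen_Iio).inter (hg.isOpen_inter_preimage hopen isOpen_Iio)
  have hpos := hV.measure_pos volume ⟨y, ⟨hy, hfy⟩, hy, hgy⟩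
  refine hpos.trans_le ?_
  rw [shiftMeasure, Measure.prod_restrict, ← Measure.volume_eq_prod]
  refine le_trans ?_ (Measure.le_restrict_apply _ _)
  exact measure_mono fun w hw => ⟨⟨hw.1.2, hw.2.2⟩, hw.1.1.1, Ioo_subset_Ioc_self hw.1.1.2⟩

theorem integral_maxLevel_sub_maxShifted_concave (hm₀ : Measurable Z₀) (hm₁ : Measurable Z₁)
    (h₀ : MonotoneOn Z₀ (Ioo 0 m)) (h₁ : MonotoneOn Z₁ (Ioo 0 m)) (ht : t ∈ Icc (0 : ℝ) 1) :
    (1 - t) * ∫ x, (maxLevel Z₀ x - maxShifted Z₀ x) ∂(Measure.pi fun _ : Fin l => shiftMeasure m) +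
      t * ∫ x, (maxLevel Z₁ x - maxShifted Z₁ x) ∂(Measure.pi fun _ : Fin l => shiftMeasure m) ≤
    ∫ x, (maxLevel (fun q => (1 - t) * Z₀ q + t * Z₁ q) x -
      maxShifted (fun q => (1 - t) * Z₀ q + t * Z₁ q) x)
        ∂(Measure.pi fun _ : Fin l => shiftMeasure m) := by
  have i₀ := integrable_maxLevel_sub_maxShifted (l := l) (m := m) hm₀
  have i₁ := integrable_maxLevel_sub_maxShifted (l := l) (m := m) hm₁
  have hmt : Measurable fun q => (1 - t) * Z₀ q + t * Z₁ q :=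
    (hm₀.const_mul (1 - t)).add (hm₁.const_mul t)
  have it := integrable_maxLevel_sub_maxShifted (l := l) (m := m) hmt
  rw [← integral_const_mul, ← integral_const_mul, ← integral_add (i₀.const_mul _) (i₁.const_mul _)]
  refine integral_mono_ae ((i₀.const_mul _).add (i₁.const_mul _)) it ?_
  filter_upwards [ae_mem_of_shiftMeasure] with x hx
  exact sub_maxShifted_concave h₀ h₁ ht fun i => (hx i).1

theorem integral_maxLevel_sub_maxShifted_strictConcave (hl : 2 ≤ l)
    (hm₀ : Measurable Z₀) (hm₁ : Measurable Z₁)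
    (h₀ : MonotoneOn Z₀ (Ioo 0 m)) (h₁ : MonotoneOn Z₁ (Ioo 0 m))
    (hc₀ : ContinuousOn Z₀ (Ioo 0 m)) (hc₁ : ContinuousOn Z₁ (Ioo 0 m))
    {a b : ℝ} (ha : a ∈ Ioo 0 m) (hb : b ∈ Ioo 0 m) (hab : Z₀ a - Z₁ a ≠ Z₀ b - Z₁ b)
    (ht : t ∈ Ioo (0 : ℝ) 1) :
    (1 - t) * ∫ x, (maxLevel Z₀ x - maxShifted Z₀ x) ∂(Measure.pi fun _ : Fin l => shiftMeasure m) +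
      t * ∫ x, (maxLevel Z₁ x - maxShifted Z₁ x) ∂(Measure.pi fun _ : Fin l => shiftMeasure m) <
    ∫ x, (maxLevel (fun q => (1 - t) * Z₀ q + t * Z₁ q) x -
      maxShifted (fun q => (1 - t) * Z₀ q + t * Z₁ q) x)
        ∂(Measure.pi fun _ : Fin l => shiftMeasure m) := by
  have ht' : t ∈ Icc (0 : ℝ) 1 := Ioo_subset_Icc_self ht
  have i₀ := integrable_maxLevel_sub_maxShifted (l := l) (m := m) hm₀
  have i₁ := integrable_maxLevel_sub_maxShifted (l := l) (m := m) hm₁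
  have hmt : Measurable fun q => (1 - t) * Z₀ q + t * Z₁ q :=
    (hm₀.const_mul (1 - t)).add (hm₁.const_mul t)
  have it := integrable_maxLevel_sub_maxShifted (l := l) (m := m) hmt
  have ic : Integrable (fun x => (1 - t) * (maxLevel Z₀ x - maxShifted Z₀ x) +
      t * (maxLevel Z₁ x - maxShifted Z₁ x)) (Measure.pi fun _ : Fin l => shiftMeasure m) :=
    (i₀.const_mul (1 - t)).add (i₁.const_mul t)
  rw [← integral_const_mul, ← integral_const_mul, ← integral_add (i₀.const_mul _) (i₁.const_mul _),
    ← sub_pos, ← integral_sub it ic]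
  refine (integral_pos_iff_support_of_nonneg_ae ?_ (it.sub ic)).2 ?_
  · filter_upwards [ae_mem_of_shiftMeasure] with x hx
    exact sub_nonneg.2 (sub_maxShifted_concave h₀ h₁ ht' fun i => (hx i).1)
  obtain ⟨q, hq, q', hq', u, hu, u', hu', hlt₀, hlt₁⟩ := exists_crossing hc₀ hc₁ ha hb hab
  obtain ⟨c₀, hc, hc'⟩ := exists_between hlt₀
  obtain ⟨c₁, hd, hd'⟩ := exists_between hlt₁
  let j : Fin l := ⟨0, by omega⟩
  let k : Fin l := ⟨1, by omega⟩
  have hkj : k ≠ j := by simp [k, j]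
  let V : Set (ℝ × ℝ) := {y | c₀ - (Z₀ y.1 - y.2) < 0 ∧ (Z₁ y.1 - y.2) - c₁ < 0}
  let V' : Set (ℝ × ℝ) := {y | (Z₀ y.1 - y.2) - c₀ < 0 ∧ c₁ - (Z₁ y.1 - y.2) < 0}
  have hcont : ∀ {Z : ℝ → ℝ}, ContinuousOn Z (Ioo 0 m) →
      ContinuousOn (fun y : ℝ × ℝ => Z y.1 - y.2) (Ioo 0 m ×ˢ Ioo 0 1) := fun hZ =>
    (hZ.comp continuousOn_fst fun y hy => hy.1).sub continuousOn_snd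
  have hVpos : 0 < shiftMeasure m V :=
    shiftMeasure_pos_of_continuousOn (continuousOn_const.sub (hcont hc₀))
      ((hcont hc₁).sub continuousOn_const) (y := (q, u)) ⟨hq, hu⟩ (by simpa using hc')
      (by simpa using hd)
  have hVpos' : 0 < shiftMeasure m V' :=
    shiftMeasure_pos_of_continuousOn ((hcont hc₀).sub continuousOn_const)
      (continuousOn_const.sub (hcont hc₁)) (y := (q', u')) ⟨hq', hu'⟩ (by simpa using hc)
      (by simpa using hd')
  -- In this box coordinate `j` trails all others for `Z₀` and leads them for `Z₁`.
  have hbox : 0 < (Measure.pi fun _ : Fin l => shiftMeasure m)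
      (univ.pi fun i => if i = j then V' else V) := by
    rw [Measure.pi_pi]
    refine CanonicallyOrderedAdd.prod_pos.2 fun i _ => ?_
    split_ifs
    · exact hVpos'
    · exact hVpos
  -- Linearity of `maxLevel` needs levels in `(0, m)`, which `V` and `V'` do not enforce.
  have hbox' : 0 < (Measure.pi fun _ : Fin l => shiftMeasure m)
      ((univ.pi fun i => if i = j then V' else V) ∩
        {x | ∀ i, (x i).1 ∈ Ioo 0 m ∧ (x i).2 ∈ Ioc (0 : ℝ) 1}) := by
    rwa [measure_inter_conull (ae_mem_of_shiftMeasure (l := l) (m := m))]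
  refine hbox'.trans_le (measure_mono fun x hx => ?_)
  have hxV : ∀ i ≠ j, x i ∈ V := fun i hi => by simpa [hi] using hx.1 i (mem_univ i)
  have hxj : x j ∈ V' := by simpa using hx.1 j (mem_univ j)
  have hlt := maxShifted_convexCombo_lt (Z₀ := Z₀) (Z₁ := Z₁) ht hkj
    (fun i hi => ⟨sub_neg.1 (hxV i hi).1, sub_neg.1 (hxV i hi).2⟩)
    ⟨sub_neg.1 hxj.1, sub_neg.1 hxj.2⟩
  have heq := maxLevel_convexCombo h₀ h₁ ht' fun i => (hx.2 i).1
  refine (sub_pos.2 ?_).ne'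
  beta_reduce
  rw [heq]
  linarith

end Convexity

/-! ### Displacement convexity of the potential. -/

section Potential

variable {l r : ℕ} {p₀ p₁ : ℝ → ℝ} {t : ℝ}

/-- Along the interpolation the potential differs from the linear one only through the
interaction term. -/
theorem potential_interpolatedProfile [NeZero l] (hl : 2 ≤ l) (hr : 2 ≤ r)
    (hp₀ : p₀ ∈ increasingProfiles (pMAP l r)) (hp₁ : p₁ ∈ increasingProfiles (pMAP l r))
    (ht : t ∈ Icc (0 : ℝ) 1) :
    potential l r (epsMAP l r) (interpolatedProfile p₀ p₁ t) =
      (1 - t) * potential l r (epsMAP l r) p₀ + t * potential l r (epsMAP l r) p₁ -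
      epsMAP l r / l *
        (∫ x, (maxLevel (fun q => (1 - t) * (inverseProfile p₀ q).toReal +
              t * (inverseProfile p₁ q).toReal) x -
            maxShifted (fun q => (1 - t) * (inverseProfile p₀ q).toReal +
              t * (inverseProfile p₁ q).toReal) x)
          ∂(Measure.pi fun _ : Fin l => shiftMeasure (pMAP l r)) -
        ((1 - t) * ∫ x, (maxLevel (fun q => (inverseProfile p₀ q).toReal) x -
            maxShifted (fun q => (inverseProfile p₀ q).toReal) x)
          ∂(Measure.pi fun _ : Fin l => shiftMeasure (pMAP l r)) +
        t * ∫ x, (maxLevel (fun q => (inverseProfile p₁ q).toReal) x -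
            maxShifted (fun q => (inverseProfile p₁ q).toReal) x)
          ∂(Measure.pi fun _ : Fin l => shiftMeasure (pMAP l r)))) := by
  have v₀ := isProfileInverse_toReal hp₀
  have v₁ := isProfileInverse_toReal hp₁
  have i₀ := integrableOn_singleDeriv_mul_inverse hl hr hp₀ v₀
  have i₁ := integrableOn_singleDeriv_mul_inverse hl hr hp₁ v₁
  rw [(potential_eq_integral_inverse hl hr hp₀ v₀).2, (potential_eq_integral_inverse hl hr hp₁ v₁).2,
    (potential_eq_integral_inverse hl hr (interpolatedProfile_mem_increasingProfiles hp₀ hp₁ ht)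
      (isProfileInverse_interpolatedProfile hp₀ hp₁ ht)).2]
  have hlin : ∫ q in Ioo 0 (pMAP l r), singleDeriv l r (epsMAP l r) q *
        ((1 - t) * (inverseProfile p₀ q).toReal + t * (inverseProfile p₁ q).toReal) =
      (1 - t) * (∫ q in Ioo 0 (pMAP l r), singleDeriv l r (epsMAP l r) q *
        (inverseProfile p₀ q).toReal) +
      t * ∫ q in Ioo 0 (pMAP l r), singleDeriv l r (epsMAP l r) q *
        (inverseProfile p₁ q).toReal := by
    rw [← integral_const_mul, ← integral_const_mul,
      ← integral_add (i₀.const_mul _) (i₁.const_mul _)]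
    refine integral_congr_ae (ae_of_all _ fun q => ?_)
    simp only
    ring
  rw [hlin]
  ring

theorem displacementConvexOn_potential (hl : 2 ≤ l) (hr : 2 ≤ r) :
    DisplacementConvexOn (increasingProfiles (pMAP l r)) (potential l r (epsMAP l r)) := by
  have : NeZero l := ⟨by omega⟩
  intro p₀ hp₀ p₁ hp₁ t ht
  refine ⟨interpolatedProfile_mem_increasingProfiles hp₀ hp₁ ht, ?_⟩
  have v₀ := isProfileInverse_toReal hp₀
  have v₁ := isProfileInverse_toReal hp₁
  have hε : 0 ≤ epsMAP l r / l :=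
    div_nonneg (epsMAP_mem (by omega) hr).1.1 (Nat.cast_nonneg l)
  rw [potential_interpolatedProfile hl hr hp₀ hp₁ ht]
  exact sub_le_self _ (mul_nonneg hε (sub_nonneg.2 (integral_maxLevel_sub_maxShifted_concave
    v₀.measurable v₁.measurable v₀.monotoneOn v₁.monotoneOn ht)))

theorem strictDisplacementConvexOn_potential (hl : 2 ≤ l) (hr : 2 ≤ r) :
    StrictDisplacementConvexOn (pinnedProfiles (pMAP l r)) (potential l r (epsMAP l r)) := by
  have : NeZero l := ⟨by omega⟩
  refine ⟨fun p₀ hp₀ p₁ hp₁ t ht => interpolatedProfile_mem_pinnedProfiles hp₀ hp₁ ht,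
    fun p₀ hp₀ p₁ hp₁ hne t ht => ?_⟩
  have hi₀ := strictProfiles_subset hp₀.1
  have hi₁ := strictProfiles_subset hp₁.1
  have v₀ := isProfileInverse_toReal hi₀
  have v₁ := isProfileInverse_toReal hi₁
  -- The mere existence of a strictly increasing profile forces `pMAP > 0`.
  have hm : 0 < pMAP l r := (pos_of_mem_strictProfiles hp₀.1 0).trans
    (lt_of_mem_strictProfiles hp₀.1 0)
  have hε : 0 < epsMAP l r / l :=
    div_pos (epsMAP_pos (by omega) hr hm) (Nat.cast_pos.2 (by omega))
  have hmid : pMAP l r / 2 ∈ Ioo 0 (pMAP l r) := ⟨by linarith, by linarith⟩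
  -- Pinning makes both inverses vanish at `pMAP / 2`, so any level where they differ shows that
  -- their difference is not constant.
  have z₀ := hp₀.1.2.injective ((v₀.apply_inverse hi₀.1.1 hmid).trans hp₀.2.symm)
  have z₁ := hp₁.1.2.injective ((v₁.apply_inverse hi₁.1.1 hmid).trans hp₁.2.symm)
  obtain ⟨b, hb, hneb⟩ : ∃ b ∈ Ioo 0 (pMAP l r),
      (inverseProfile p₀ b).toReal ≠ (inverseProfile p₁ b).toReal := by
    by_contra! hcon
    exact hne (v₀.eq_of_eqOn v₁ hi₀.1.2.1 (le_of_mem_increasingProfiles hi₀) hi₁.1.2.1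
      (le_of_mem_increasingProfiles hi₁) hcon)
  rw [potential_interpolatedProfile hl hr hi₀ hi₁ (Ioo_subset_Icc_self ht)]
  refine sub_lt_self _ (mul_pos hε (sub_pos.2 (integral_maxLevel_sub_maxShifted_strictConcave hl
    v₀.measurable v₁.measurable v₀.monotoneOn v₁.monotoneOn
    (v₀.continuousOn hi₀.1.1 hp₀.1.2) (v₁.continuousOn hi₁.1.1 hp₁.1.2) hmid hb ?_ ht)))
  rw [z₀, z₁, sub_self]
  exact (sub_ne_zero.2 hneb).symm

end Potential

end SpatialCoupling

theorem theorem2 (l r : ℕ) (hl : 3 ≤ l) (hlr : l ≤ r) :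
    (∀ p ∈ SpatialCoupling.increasingProfiles (SpatialCoupling.pMAP l r),
      MeasureTheory.Integrable
        (SpatialCoupling.potentialDensity l r (SpatialCoupling.epsMAP l r) p)) ∧
    SpatialCoupling.DisplacementConvexOn
      (SpatialCoupling.increasingProfiles (SpatialCoupling.pMAP l r))
      (SpatialCoupling.potential l r (SpatialCoupling.epsMAP l r)) ∧
    SpatialCoupling.StrictDisplacementConvexOn
      (SpatialCoupling.pinnedProfiles (SpatialCoupling.pMAP l r))
      (SpatialCoupling.potential l r (SpatialCoupling.epsMAP l r)) := by
  have hl2 : 2 ≤ l := by omega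
  have hr2 : 2 ≤ r := by omega
  have : NeZero l := ⟨by omega⟩
  exact ⟨fun p hp => (SpatialCoupling.potential_eq_integral_inverse hl2 hr2 hp
      (SpatialCoupling.isProfileInverse_toReal hp)).1,
    SpatialCoupling.displacementConvexOn_potential hl2 hr2,
    SpatialCoupling.strictDisplacementConvexOn_potential hl2 hr2⟩
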